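/- Let $n_x\ge 0$, $n_u\ge 1$ and $i\in\{1,\dots,n_u\}$, let $B_0\in\mathbb R^{n_x\times n_u}$ with $i$-th column $[B_0]_i$ and $B_i\in\mathbb R^{n_x\times n_x}$ be unknown, and consider the affine system $$\mathcal S_i:\quad x_t^+=[B_0]_i+B_ix_t+w_t ,\qquad t=1,\dots,T_i .$$ Let $x_1,\dots,x_{T_i}$ be i.i.d. random vectors in $\mathbb R^{n_x}$ (with any distribution), let $w_1,\dots,w_{T_i}$ be i.i.d. with $w_t\sim\mathcal N(0,\sigma_w^2I_{n_x})$, $\sigma_w\ge 0$, and let $(w_t)_t$ be independent of $(x_t)_t$. Let $[\hat B_i\ \ [\hat B_0]_i]$ be an ordinary least-squares estimate, i.e. any minimiser over $\theta\in\mathbb R^{n_x\times(n_x+1)}$ of $\sum_{t=1}^{T_i}\bigl\|x_t^+-\theta\begin{bmatrix}x_t\\1\end{bmatrix}\bigr\|_2^2$. For a scale $\sigma_x>0$ put $\xi_t=x_t/\sigma_x$ and $$M_i=\begin{bmatrix}\sum_{t}\xi_t\xi_t^\top&\sum_t\xi_t\\ \sum_t\xi_t^\top&T_i\end{bmatrix},\qquad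 E=\begin{bmatrix}\sigma_x(\hat B_i-B_i)^\top\\([\hat B_0]_i-[B_0]_i)^\top\end{bmatrix}.$$ Fix $\delta\in(0,1)$, assume $T_i\ge n_x+1$, and define $$C_1(n_x,\delta)=\sigma_w^2\Bigl(\sqrt{n_x+1}+\sqrt{n_x}+\sqrt{2\log(2n_u/\delta)}\Bigr)^2 .$$ Then with probability at least $1-\frac{\delta}{2n_u}$ every such least-squares estimate satisfies $$E\,E^\top\preceq C_1(n_x,\delta)\,M_i^{-1}.$$ Here, if $M_i$ has zero as an eigenvalue, the inverse of that eigenvalue is defined to be $\infty$: with eigenvalues $\lambda_j$ and orthonormal eigenvectors $q_j$ of $M_i$, the inequality means $v^\top EE^\top v\le C_1(n_x,\delta)\sum_j\lambda_j^{-1}(q_j^\top v)^2$ for all $v\in\mathbb R^{n_x+1}$, with $0^{-1}=\infty$, $\infty\cdot 0=0$ inside the sum, and no constraint on $v$ when the sum is infinite. In particular, for $\sigma_x=1$ one has $M_i=\sum_t\begin{bmatrix}x_t\\1\end{bmatrix}\begin{bmatrix}x_t\\1\end{bmatrix}^\top$ and $E=\begin{bmatrix}\hat B_i-B_i&[\hat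 B_0]_i-[B_0]_i\end{bmatrix}^\top$. -/

import Mathlib

open MeasureTheory ProbabilityTheory
open scoped ENNReal Matrix

noncomputable section

namespace BilinearId

/-- One step of the affine subsystem `x⁺ = b + B x + w`. -/
def affineStep {nx : ℕ} (B : Matrix (Fin nx) (Fin nx) ℝ) (b : Fin nx → ℝ)
    (x w : EuclideanSpace ℝ (Fin nx)) : EuclideanSpace ℝ (Fin nx) :=
  WithLp.toLp 2 (b + B *ᵥ x.ofLp) + w

/-- The parameter matrix `θ = [B  b]`. -/
def param {nx : ℕ} (B : Matrix (Fin nx) (Fin nx) ℝ) (b : Fin nx → ℝ) :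
    Matrix (Fin nx) (Fin nx ⊕ Unit) ℝ :=
  Matrix.fromCols B (Matrix.replicateCol Unit b)

/-- The regressor `y = (x, 1)`. -/
def regressor {nx : ℕ} (x : EuclideanSpace ℝ (Fin nx)) : Fin nx ⊕ Unit → ℝ :=
  Sum.elim x.ofLp (fun _ => 1)

/-- The least-squares cost `∑ₜ ‖xₜ⁺ - θ yₜ‖²`. -/
def lsCost {nx T : ℕ} (x xplus : Fin T → EuclideanSpace ℝ (Fin nx))
    (θ : Matrix (Fin nx) (Fin nx ⊕ Unit) ℝ) : ℝ :=
  ∑ t, ‖xplus t - WithLp.toLp 2 (θ *ᵥ regressor (x t))‖ ^ 2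

/-- `θ` is an ordinary least-squares estimate: a minimiser of the least-squares cost. -/
def IsOLS {nx T : ℕ} (x xplus : Fin T → EuclideanSpace ℝ (Fin nx))
    (θ : Matrix (Fin nx) (Fin nx ⊕ Unit) ℝ) : Prop :=
  ∀ θ', lsCost x xplus θ ≤ lsCost x xplus θ'

/-- The data matrix `M = [∑ ξₜ ξₜᵀ, ∑ ξₜ; ∑ ξₜᵀ, T]`, where `ξₜ = xₜ / σx`. -/
def dataMatrix {nx T : ℕ} (σx : ℝ) (x : Fin T → EuclideanSpace ℝ (Fin nx)) :
    Matrix (Fin nx ⊕ Unit) (Fin nx ⊕ Unit) ℝ :=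
  let ξ : Fin T → Fin nx → ℝ := fun t => σx⁻¹ • (x t).ofLp
  Matrix.fromBlocks
    (∑ t, Matrix.vecMulVec (ξ t) (ξ t))
    (Matrix.replicateCol Unit (∑ t, ξ t))
    (Matrix.replicateRow Unit (∑ t, ξ t))
    (Matrix.of fun _ _ => (T : ℝ))

theorem dataMatrix_isHermitian {nx T : ℕ} (σx : ℝ) (x : Fin T → EuclideanSpace ℝ (Fin nx)) :
    (dataMatrix σx x).IsHermitian := by
  ext i j
  rcases i with i | i <;> rcases j with j | j <;>
    simp [dataMatrix, Matrix.sum_apply, Matrix.vecMulVec_apply, mul_comm]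

/-- The stacked error `[σx (B̂ - B)ᵀ ; (b̂ - b)ᵀ]`, i.e. the transposed parameter error with the
state block expressed in the units of `ξ = x / σx`. For `σx = 1` it is `(θ̂ - θ)ᵀ`. -/
def stackedError {nx : ℕ} (σx : ℝ) (θhat θ : Matrix (Fin nx) (Fin nx ⊕ Unit) ℝ) :
    Matrix (Fin nx ⊕ Unit) (Fin nx) ℝ :=
  Matrix.diagonal (Sum.elim (fun _ => σx) (fun _ => 1)) * (θhat - θ)ᵀ

/-- The quadratic form `v ↦ vᵀ M⁻¹ v = ∑ⱼ λⱼ⁻¹ ⟨qⱼ, v⟩²` of the inverse of a positive semidefinite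
matrix `M` with eigenvalues `λⱼ` and orthonormal eigenvectors `qⱼ`, where the inverse of a zero
eigenvalue is `∞` (and `∞ * 0 = 0`). -/
def invQuadForm {n : Type} [Fintype n] [DecidableEq n] {M : Matrix n n ℝ}
    (hM : M.IsHermitian) (v : n → ℝ) : ℝ≥0∞ :=
  ∑ j, (ENNReal.ofReal (hM.eigenvalues j))⁻¹ *
    ENNReal.ofReal (((hM.eigenvectorBasis j).ofLp ⬝ᵥ v) ^ 2)

/-- The Loewner inequality `P ⪯ c M⁻¹`, where zero eigenvalues of `M` have inverse `∞`: in the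
directions `v` with `vᵀ M⁻¹ v = ∞` the right-hand side is infinite (for `c = 0` as well). -/
def LoewnerLEInv {n : Type} [Fintype n] [DecidableEq n] (P : Matrix n n ℝ) (c : ℝ)
    {M : Matrix n n ℝ} (hM : M.IsHermitian) : Prop :=
  ∀ v : n → ℝ, invQuadForm hM v ≠ ∞ →
    ENNReal.ofReal (v ⬝ᵥ (P *ᵥ v)) ≤ ENNReal.ofReal c * invQuadForm hM v

theorem invQuadForm_of_posDef {n : Type} [Fintype n] [DecidableEq n] {M : Matrix n n ℝ}
    (hM : M.PosDef) (v : n → ℝ) :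
    invQuadForm hM.isHermitian v = ENNReal.ofReal (v ⬝ᵥ (M⁻¹ *ᵥ v)) := by
  set b := hM.isHermitian.eigenvectorBasis with hb
  have hinv : ∀ j, M⁻¹ *ᵥ (b j).ofLp = (hM.isHermitian.eigenvalues j)⁻¹ • (b j).ofLp := by
    intro j
    have h1 := hM.isHermitian.mulVec_eigenvectorBasis j
    have hpos := hM.eigenvalues_pos j
    have h2 : M⁻¹ *ᵥ (M *ᵥ (b j).ofLp) = (b j).ofLp := by
      rw [Matrix.mulVec_mulVec, Matrix.nonsing_inv_mul _ ((Matrix.isUnit_iff_isUnit_det M).1 hM.isUnit),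
        Matrix.one_mulVec]
    rw [h1, Matrix.mulVec_smul] at h2
    rw [eq_inv_smul_iff₀ hpos.ne']
    exact h2
  have hv : v = ∑ j, ((b j).ofLp ⬝ᵥ v) • (b j).ofLp := by
    have := congrArg WithLp.ofLp (b.sum_repr' (WithLp.toLp 2 v))
    simp only [WithLp.ofLp_sum, WithLp.ofLp_smul,
      EuclideanSpace.inner_eq_star_dotProduct, star_trivial] at this
    conv_lhs => rw [← this]
    exact Finset.sum_congr rfl fun j _ => by rw [dotProduct_comm]
  have hq : v ⬝ᵥ (M⁻¹ *ᵥ v) =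
      ∑ j, (hM.isHermitian.eigenvalues j)⁻¹ * ((b j).ofLp ⬝ᵥ v) ^ 2 := by
    have hMv : M⁻¹ *ᵥ v = ∑ j, ((b j).ofLp ⬝ᵥ v) • M⁻¹ *ᵥ (b j).ofLp := by
      conv_lhs => rw [hv]
      rw [Matrix.mulVec_sum]
      simp [Matrix.mulVec_smul]
    rw [hMv, dotProduct_sum]
    refine Finset.sum_congr rfl fun j _ => ?_
    rw [hinv, dotProduct_smul, dotProduct_smul, dotProduct_comm v]
    simp only [smul_eq_mul]
    ring
  rw [hq, invQuadForm, ENNReal.ofReal_sum_of_nonneg]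
  · refine Finset.sum_congr rfl fun j _ => ?_
    have hpos := hM.eigenvalues_pos j
    rw [ENNReal.ofReal_mul (inv_nonneg.2 hpos.le), ENNReal.ofReal_inv_of_pos hpos]
  · intro j _
    have hpos := hM.eigenvalues_pos j
    positivity

/-- For positive definite `M` the inequality is the usual Loewner inequality. -/
theorem loewnerLEInv_iff_of_posDef {n : Type} [Fintype n] [DecidableEq n] {P M : Matrix n n ℝ}
    (hP : P.PosSemidef) {c : ℝ} (hc : 0 ≤ c) (hM : M.PosDef) :
    LoewnerLEInv P c hM.isHermitian ↔ (c • M⁻¹ - P).PosSemidef := by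
  have hH : (c • M⁻¹ - P).IsHermitian := by
    have h1 := hM.isHermitian.inv
    have h2 := hP.isHermitian
    unfold Matrix.IsHermitian at *
    rw [Matrix.conjTranspose_sub, Matrix.conjTranspose_smul, h1, h2]
    simp
  rw [Matrix.posSemidef_iff_dotProduct_mulVec]
  simp only [hH, true_and, LoewnerLEInv, invQuadForm_of_posDef hM, star_trivial,
    ne_eq, ENNReal.ofReal_ne_top, not_false_eq_true, true_imp_iff]
  refine forall_congr' fun v => ?_
  have h0 : 0 ≤ v ⬝ᵥ (M⁻¹ *ᵥ v) := by
    simpa using hM.inv.posSemidef.dotProduct_mulVec_nonneg v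
  rw [← ENNReal.ofReal_mul hc, ENNReal.ofReal_le_ofReal_iff (mul_nonneg hc h0),
    Matrix.sub_mulVec, dotProduct_sub, Matrix.smul_mulVec, dotProduct_smul, smul_eq_mul,
    sub_nonneg]

/-- `C₁ = σw² (√(nx+1) + √nx + √(2 log(2 nu / δ)))²`. -/
def C₁ (σw : ℝ) (nx nu : ℕ) (δ : ℝ) : ℝ :=
  σw ^ 2 * (√((nx : ℝ) + 1) + √(nx : ℝ) + √(2 * Real.log (2 * (nu : ℝ) / δ))) ^ 2

end BilinearId

end

set_option linter.unusedSectionVars false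

/-! Write `y = (x, 1)` and `ξ = x / σx`. The normal equations say that the residuals are orthogonal
to the column space of the regressors. For `a = M u` they give `Eᵀ a = ∑ ⟨u, (ξₜ, 1)⟩ wₜ`. If the
noise, as a bilinear form on (column space) × (state space), has norm at most `κ`, pairing this
identity with `Eᵀ a` itself gives `‖Eᵀ a‖² ≤ κ √(uᵀ M u) ‖Eᵀ a‖`, hence `‖Eᵀ a‖² ≤ κ² uᵀ M u = κ² aᵀ
M⁻¹ a`. Directions outside the range of `M` carry no constraint, so a singular `M` does no harm
(`loewnerLEInv_of_isOLS`).

It remains to bound the noise. With the states frozen, the column space is a fixed subspace of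
dimension at most `nx + 1`, and the noise is `σw` times a Gaussian matrix. The Davidson-Szarek bound
makes its norm exceed `σw (√(nx+1) + √nx + s)` with probability at most `exp (-s²/2)`. Independence
and Fubini remove the conditioning, whatever the law of the states.

The Davidson-Szarek bound is proved without a separate concentration inequality. Slepian
interpolation compares `⟨z vᵀ, G⟩ + g` with `⟨z, g₁⟩ + ⟨v, g₂⟩` on the test functional `(∑ exp (β
·)) ^ r`, where `β = l / r`; as `r → 0` this becomes the exponential moment of order `l` of the
maximum. The scalar `g` cancels one of the two factors `exp (l²/2)` produced by `‖g₁‖` and `‖g₂‖`,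
so that Markov's inequality yields the exact exponent `-s²/2`. -/

namespace ProbabilityTheory

/-! ### Gaussian density, integration by parts and exponential moments of the norm. -/

section GaussianDensity

variable {E : Type*} [NormedAddCommGroup E] [InnerProductSpace ℝ E] [FiniteDimensional ℝ E]
  [MeasurableSpace E] [BorelSpace E]

/-- The density of the standard Gaussian measure with respect to the Lebesgue measure. -/
noncomputable def stdGaussianPDF (x : E) : ℝ :=
  (2 * Real.pi) ^ (-(Module.finrank ℝ E / 2 : ℝ)) * Real.exp (-(1 / 2) * ‖x‖ ^ 2)

lemma stdGaussianPDF_pos (x : E) : 0 < stdGaussianPDF x := by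
  unfold stdGaussianPDF; positivity

lemma continuous_stdGaussianPDF : Continuous (stdGaussianPDF : E → ℝ) := by
  unfold stdGaussianPDF; fun_prop

lemma integrable_stdGaussianPDF : Integrable (stdGaussianPDF : E → ℝ) := by
  have h := GaussianFourier.integrable_cexp_neg_mul_sq_norm_add (V := E) (b := (1 / 2 : ℂ))
    (by norm_num) 0 0
  refine Integrable.const_mul ?_ _
  refine h.norm.congr (Filter.Eventually.of_forall fun x => ?_)
  simp only [Complex.norm_exp]
  congr 1
  rw [show (-(1 / 2 : ℂ) * (‖x‖ : ℂ) ^ 2 + 0 * ((inner ℝ (0 : E) x : ℝ) : ℂ))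
    = ((-(1 / 2) * ‖x‖ ^ 2 : ℝ) : ℂ) by push_cast; ring]
  exact Complex.ofReal_re _

/-- Both sides have the same characteristic function: the complex Gaussian integral with linear
coefficient `I` produces `exp (-‖t‖²/2)` and a power of `2π` that the normalisation cancels. -/
lemma stdGaussian_eq_withDensity :
    stdGaussian E = volume.withDensity fun x => ENNReal.ofReal (stdGaussianPDF x) := by
  have : IsFiniteMeasure ((volume : Measure E).withDensity
      fun x => ENNReal.ofReal (stdGaussianPDF x)) :=
    isFiniteMeasure_withDensity_ofReal integrable_stdGaussianPDF.2
  refine Measure.ext_of_charFun (funext fun t => ?_)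
  rw [charFun_stdGaussian, charFun_apply, integral_withDensity_eq_integral_toReal_smul
    (by have := continuous_stdGaussianPDF (E := E); fun_prop)
    (Filter.Eventually.of_forall fun x => ENNReal.ofReal_lt_top)]
  have h := GaussianFourier.integral_cexp_neg_mul_sq_norm_add (V := E) (b := (1 / 2 : ℂ))
    (by norm_num) Complex.I t
  have h2 : ∀ x : E, (ENNReal.ofReal (stdGaussianPDF x)).toReal •
      Complex.exp (((inner ℝ x t : ℝ) : ℂ) * Complex.I) =
      (((2 * Real.pi) ^ (-(Module.finrank ℝ E / 2 : ℝ)) : ℝ) : ℂ) *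
      Complex.exp (-(1 / 2 : ℂ) * (‖x‖ : ℂ) ^ 2 + Complex.I * ((inner ℝ t x : ℝ) : ℂ)) := by
    intro x
    rw [ENNReal.toReal_ofReal (stdGaussianPDF_pos x).le, stdGaussianPDF, Complex.real_smul,
      Complex.exp_add, real_inner_comm]
    push_cast
    ring_nf
  simp_rw [h2]
  rw [integral_const_mul, h, Complex.I_sq, ← mul_assoc]
  have h3 : (((2 * Real.pi) ^ (-(Module.finrank ℝ E / 2 : ℝ)) : ℝ) : ℂ) *
      ((Real.pi : ℂ) / (1 / 2)) ^ ((Module.finrank ℝ E : ℂ) / 2) = 1 := by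
    rw [show (Real.pi : ℂ) / (1 / 2) = ((2 * Real.pi : ℝ) : ℂ) by push_cast; ring,
      show (Module.finrank ℝ E : ℂ) / 2 = ((Module.finrank ℝ E / 2 : ℝ) : ℂ) by push_cast; ring,
      ← Complex.ofReal_cpow (by positivity), ← Complex.ofReal_mul,
      ← Real.rpow_add (by positivity)]
    simp
  rw [h3, one_mul]
  congr 1
  ring

lemma integral_stdGaussian (f : E → ℝ) :
    ∫ x, f x ∂stdGaussian E = ∫ x, stdGaussianPDF x * f x := by
  rw [stdGaussian_eq_withDensity, integral_withDensity_eq_integral_toReal_smul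
    (by have := continuous_stdGaussianPDF (E := E); fun_prop)
    (Filter.Eventually.of_forall fun x => ENNReal.ofReal_lt_top)]
  simp [ENNReal.toReal_ofReal (stdGaussianPDF_pos _).le]

lemma integrable_stdGaussian_iff (f : E → ℝ) :
    Integrable f (stdGaussian E) ↔ Integrable fun x => stdGaussianPDF x * f x := by
  rw [stdGaussian_eq_withDensity, integrable_withDensity_iff_integrable_smul'
    (by have := continuous_stdGaussianPDF (E := E); fun_prop)
    (Filter.Eventually.of_forall fun x => ENNReal.ofReal_lt_top)]
  simp [ENNReal.toReal_ofReal (stdGaussianPDF_pos _).le]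

lemma hasFDerivAt_stdGaussianPDF (x : E) :
    HasFDerivAt stdGaussianPDF (-stdGaussianPDF x • innerSL ℝ x) x := by
  have h := (((hasStrictFDerivAt_norm_sq x).hasFDerivAt.const_mul (-(1 / 2 : ℝ))).exp).const_mul
    ((2 * Real.pi) ^ (-(Module.finrank ℝ E / 2 : ℝ)))
  refine h.congr_fderiv ?_
  ext y
  simp [stdGaussianPDF]
  ring

/-- **Stein's lemma**: Gaussian integration by parts. -/
theorem integral_inner_mul_stdGaussian {f : E → ℝ} (hf : Differentiable ℝ f) (a : E)
    (hfi : Integrable f (stdGaussian E))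
    (hf' : Integrable (fun x => fderiv ℝ f x a) (stdGaussian E))
    (hif : Integrable (fun x => inner ℝ a x * f x) (stdGaussian E)) :
    ∫ x, inner ℝ a x * f x ∂stdGaussian E = ∫ x, fderiv ℝ f x a ∂stdGaussian E := by
  rw [integrable_stdGaussian_iff] at hfi hf' hif
  rw [integral_stdGaussian, integral_stdGaussian]
  have hd : ∀ x, fderiv ℝ (stdGaussianPDF : E → ℝ) x a = -(stdGaussianPDF x * inner ℝ a x) := by
    intro x
    rw [(hasFDerivAt_stdGaussianPDF x).fderiv]
    simp [real_inner_comm]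
  have := integral_mul_fderiv_eq_neg_fderiv_mul_of_integrable (𝕜 := ℝ) (μ := (volume : Measure E))
    (f := stdGaussianPDF) (g := f) (v := a)
    (by refine hif.neg.congr (Filter.Eventually.of_forall fun x => ?_)
        simp only [hd, Pi.neg_apply]; ring) hf' hfi
    (fun x _ => (hasFDerivAt_stdGaussianPDF x).differentiableAt) (fun x _ => hf x)
  rw [this, ← integral_neg]
  congr 1 with x
  rw [hd]; ring

/-- Fernique's theorem makes some `exp (C ‖x‖²)` integrable, and completing the square dominates `c
‖x‖` by `c²/(4C) + C ‖x‖²`. All later integrability claims reduce to this growth class. -/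
lemma integrable_exp_mul_norm_stdGaussian (c : ℝ) :
    Integrable (fun x : E => Real.exp (c * ‖x‖)) (stdGaussian E) := by
  obtain ⟨C, hC, hi⟩ := IsGaussian.exists_integrable_exp_sq (stdGaussian E)
  refine (hi.const_mul (Real.exp (c ^ 2 / (4 * C)))).mono' (by fun_prop)
    (Filter.Eventually.of_forall fun x => ?_)
  rw [Real.norm_of_nonneg (Real.exp_pos _).le, ← Real.exp_add, Real.exp_le_exp]
  have : c ^ 2 / (4 * C) + C * ‖x‖ ^ 2 - c * ‖x‖ = (c - 2 * C * ‖x‖) ^ 2 / (4 * C) := by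
    field_simp; ring
  have h2 : 0 ≤ (c - 2 * C * ‖x‖) ^ 2 / (4 * C) := by positivity
  linarith

lemma integrable_stdGaussian_of_le_exp {f : E → ℝ} (hf : Continuous f) (C c : ℝ)
    (h : ∀ x, |f x| ≤ C * Real.exp (c * ‖x‖)) : Integrable f (stdGaussian E) :=
  ((integrable_exp_mul_norm_stdGaussian c).const_mul C).mono' hf.aestronglyMeasurable
    (Filter.Eventually.of_forall h)

lemma integral_exp_mul_sq_norm_stdGaussian {a : ℝ} (ha : a < 1 / 2) :
    Integrable (fun x : E => Real.exp (a * ‖x‖ ^ 2)) (stdGaussian E) ∧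
    ∫ x : E, Real.exp (a * ‖x‖ ^ 2) ∂stdGaussian E
      = (1 - 2 * a) ^ (-(Module.finrank ℝ E / 2 : ℝ)) := by
  have hb : 0 < 1 / 2 - a := by linarith
  have he : ∀ x : E, stdGaussianPDF x * Real.exp (a * ‖x‖ ^ 2) =
      (2 * Real.pi) ^ (-(Module.finrank ℝ E / 2 : ℝ)) * Real.exp (-(1 / 2 - a) * ‖x‖ ^ 2) := by
    intro x
    rw [stdGaussianPDF, mul_assoc, ← Real.exp_add]
    ring_nf
  rw [integrable_stdGaussian_iff, integral_stdGaussian]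
  simp_rw [he]
  constructor
  · have h := GaussianFourier.integrable_cexp_neg_mul_sq_norm_add (V := E)
      (b := ((1 / 2 - a : ℝ) : ℂ)) (by simpa using hb) 0 0
    refine Integrable.const_mul ?_ _
    refine h.norm.congr (Filter.Eventually.of_forall fun x => ?_)
    simp only [Complex.norm_exp]
    congr 1
    rw [show (-((1 / 2 - a : ℝ) : ℂ) * (‖x‖ : ℂ) ^ 2 + 0 * ((inner ℝ (0 : E) x : ℝ) : ℂ))
      = ((-(1 / 2 - a) * ‖x‖ ^ 2 : ℝ) : ℂ) by push_cast; ring]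
    exact Complex.ofReal_re _
  · rw [integral_const_mul, GaussianFourier.integral_rexp_neg_mul_sq_norm hb,
      Real.rpow_neg (by positivity), Real.rpow_neg (by linarith), ← Real.inv_rpow (by positivity),
      ← Real.inv_rpow (by linarith), ← Real.mul_rpow (by positivity) (by positivity)]
    congr 1
    have : 1 - 2 * a ≠ 0 := by linarith
    have h2 : 1 / 2 - a ≠ 0 := hb.ne'
    have := Real.pi_ne_zero
    field_simp

/-- The Laplace transform of the norm of a standard Gaussian vector. -/
theorem integral_exp_mul_norm_stdGaussian_le {l : ℝ} (hl : 0 < l) :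
    ∫ x : E, Real.exp (l * ‖x‖) ∂stdGaussian E
      ≤ Real.exp (l * √(Module.finrank ℝ E) + l ^ 2 / 2) := by
  -- Dimension zero is separate because `√d` is a denominator below.
  rcases Nat.eq_zero_or_pos (Module.finrank ℝ E) with h0 | h0
  · have : Subsingleton E := Module.finrank_zero_iff.1 h0
    have hx : ∀ x : E, Real.exp (l * ‖x‖) = 1 := fun x => by
      rw [Subsingleton.elim x 0]; simp
    simp only [hx, integral_const, probReal_univ, smul_eq_mul, one_mul]
    exact Real.one_le_exp (by positivity)
  set d : ℝ := (Module.finrank ℝ E : ℝ) with hd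
  have hdpos : 0 < d := Nat.cast_pos.2 h0
  set r := √d with hr
  have hrpos : 0 < r := Real.sqrt_pos.2 hdpos
  have hrd : r ^ 2 = d := Real.sq_sqrt hdpos.le
  -- Linearise by `l t ≤ l²/(4a) + a t²` and use the chi-square moment. This `a` makes the first
  -- term `l (√d + l)/2`, while the moment is `(1 + l/√d)^(d/2) ≤ exp (l √d / 2)`; the exponents add
  -- up exactly to `l √d + l²/2`.
  set a : ℝ := l / (2 * (r + l)) with ha
  have hapos : 0 < a := by positivity
  have ha2 : 1 - 2 * a = r / (r + l) := by rw [ha]; field_simp; ring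
  have hlt : a < 1 / 2 := by
    have : 0 < r / (r + l) := by positivity
    linarith
  obtain ⟨hi, he⟩ := integral_exp_mul_sq_norm_stdGaussian (E := E) hlt
  have h1 : ∫ x : E, Real.exp (l * ‖x‖) ∂stdGaussian E
      ≤ ∫ x : E, Real.exp (l ^ 2 / (4 * a)) * Real.exp (a * ‖x‖ ^ 2) ∂stdGaussian E := by
    refine integral_mono (integrable_exp_mul_norm_stdGaussian l) (hi.const_mul _) fun x => ?_
    simp only
    rw [← Real.exp_add, Real.exp_le_exp]
    have : l ^ 2 / (4 * a) + a * ‖x‖ ^ 2 - l * ‖x‖ = (l - 2 * a * ‖x‖) ^ 2 / (4 * a) := by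
      field_simp; ring
    have h2 : 0 ≤ (l - 2 * a * ‖x‖) ^ 2 / (4 * a) := by positivity
    linarith
  refine h1.trans ?_
  rw [integral_const_mul, he, ← hd, ha2]
  have h2 : (r / (r + l)) ^ (-(d / 2)) ≤ Real.exp (l / r * (d / 2)) := by
    rw [Real.rpow_neg (by positivity), ← Real.inv_rpow (by positivity), inv_div, Real.exp_mul]
    refine Real.rpow_le_rpow (by positivity) ?_ (by positivity)
    rw [add_div, div_self hrpos.ne', add_comm]
    exact Real.add_one_le_exp _
  refine (mul_le_mul_of_nonneg_left h2 (Real.exp_pos _).le).trans ?_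
  rw [← Real.exp_add, Real.exp_le_exp, ← hrd, ha]
  refine le_of_eq ?_
  field_simp
  ring

end GaussianDensity

end ProbabilityTheory

/-! ### Slepian's comparison for powers of sums of exponentials. -/

namespace ProbabilityTheory

section Slepian

variable {E : Type*} [NormedAddCommGroup E] [InnerProductSpace ℝ E] [FiniteDimensional ℝ E]
  [MeasurableSpace E] [BorelSpace E]
  {ι : Type*} [Fintype ι]

/-- The sum of the exponentials of `β ⟪a k, x⟫`. -/
noncomputable def expSum (β : ℝ) (a : ι → E) (x : E) : ℝ := ∑ k, Real.exp (β * inner ℝ (a k) x)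

lemma exp_le_expSum (β : ℝ) (a : ι → E) (x : E) (k : ι) :
    Real.exp (β * inner ℝ (a k) x) ≤ expSum β a x :=
  Finset.single_le_sum (f := fun k => Real.exp (β * inner ℝ (a k) x))
    (fun _ _ => (Real.exp_pos _).le) (Finset.mem_univ k)

lemma expSum_nonneg (β : ℝ) (a : ι → E) (x : E) : 0 ≤ expSum β a x :=
  Finset.sum_nonneg fun _ _ => (Real.exp_pos _).le

lemma expSum_pos [Nonempty ι] (β : ℝ) (a : ι → E) (x : E) : 0 < expSum β a x :=
  Finset.sum_pos (fun _ _ => Real.exp_pos _) Finset.univ_nonempty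

lemma continuous_expSum (β : ℝ) (a : ι → E) : Continuous (expSum β a) := by
  unfold expSum; fun_prop

lemma expSum_le {β : ℝ} (hβ : 0 ≤ β) (a : ι → E) {x : E} {C : ℝ}
    (h : ∀ k, inner ℝ (a k) x ≤ C) : expSum β a x ≤ Fintype.card ι * Real.exp (β * C) := by
  refine (Finset.sum_le_card_nsmul Finset.univ _ (Real.exp (β * C)) fun k _ => ?_).trans_eq ?_
  · exact Real.exp_le_exp.2 (mul_le_mul_of_nonneg_left (h k) hβ)
  · simp

lemma expSum_rpow_le {β r : ℝ} (hβ : 0 ≤ β) (hr : 0 ≤ r) (a : ι → E) {x : E} {C : ℝ}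
    (h : ∀ k, inner ℝ (a k) x ≤ C) :
    expSum β a x ^ r ≤ (Fintype.card ι : ℝ) ^ r * Real.exp (r * β * C) := by
  refine (Real.rpow_le_rpow (expSum_nonneg _ _ _) (expSum_le hβ a h) hr).trans_eq ?_
  rw [Real.mul_rpow (by positivity) (Real.exp_pos _).le, ← Real.exp_mul]
  ring_nf

lemma inner_le_of_norm_le {a : E} {R : ℝ} (h : ‖a‖ ≤ R) (x : E) : inner ℝ a x ≤ R * ‖x‖ :=
  (real_inner_le_norm a x).trans (mul_le_mul_of_nonneg_right h (norm_nonneg x))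

lemma abs_inner_le_of_norm_le {a : E} {R : ℝ} (h : ‖a‖ ≤ R) (x : E) : |inner ℝ a x| ≤ R * ‖x‖ :=
  (abs_real_inner_le_norm a x).trans (mul_le_mul_of_nonneg_right h (norm_nonneg x))

lemma integrable_expSum_rpow [Nonempty ι] {β r : ℝ} (hβ : 0 ≤ β) (hr : 0 ≤ r) (a : ι → E) :
    Integrable (fun x => expSum β a x ^ r) (stdGaussian E) := by
  refine integrable_stdGaussian_of_le_exp
    ((continuous_expSum β a).rpow_const fun x => Or.inl (expSum_pos β a x).ne')
    ((Fintype.card ι : ℝ) ^ r) (r * β * ∑ k, ‖a k‖) fun x => ?_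
  rw [abs_of_nonneg (Real.rpow_nonneg (expSum_nonneg _ _ _) _), mul_assoc]
  exact expSum_rpow_le hβ hr a fun k => inner_le_of_norm_le
    (Finset.single_le_sum (f := fun k => ‖a k‖) (fun _ _ => norm_nonneg _) (Finset.mem_univ k)) x

/-- The partial derivative in `z k` of `(∑ exp (β z j)) ^ r`, up to the factor `r β`. -/
noncomputable def expSumWeight (β r : ℝ) (a : ι → E) (k : ι) (x : E) : ℝ :=
  Real.exp (β * inner ℝ (a k) x) * expSum β a x ^ (r - 1)

lemma expSumWeight_nonneg (β r : ℝ) (a : ι → E) (k : ι) (x : E) :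
    0 ≤ expSumWeight β r a k x :=
  mul_nonneg (Real.exp_pos _).le (Real.rpow_nonneg (expSum_nonneg _ _ _) _)

variable [Nonempty ι]

lemma expSumWeight_le (β r : ℝ) (a : ι → E) (k : ι) (x : E) :
    expSumWeight β r a k x ≤ expSum β a x ^ r := by
  have h := expSum_pos β a x
  calc expSumWeight β r a k x ≤ expSum β a x * expSum β a x ^ (r - 1) :=
        mul_le_mul_of_nonneg_right (exp_le_expSum β a x k) (Real.rpow_nonneg h.le _)
    _ = expSum β a x ^ r := by
        rw [mul_comm, ← Real.rpow_add_one h.ne', sub_add_cancel]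

lemma continuous_expSumWeight (β r : ℝ) (a : ι → E) (k : ι) :
    Continuous (expSumWeight β r a k) := by
  unfold expSumWeight
  exact (by fun_prop : Continuous fun x => Real.exp (β * inner ℝ (a k) x)).mul
    ((continuous_expSum β a).rpow_const fun x => Or.inl (expSum_pos β a x).ne')

lemma hasFDerivAt_expSum (β : ℝ) (a : ι → E) (x : E) :
    HasFDerivAt (expSum β a)
      (∑ j, (Real.exp (β * inner ℝ (a j) x) * β) • innerSL ℝ (a j)) x := by
  unfold expSum
  refine HasFDerivAt.fun_sum fun j _ => ?_
  have h := (((innerSL ℝ (a j)).hasFDerivAt (x := x)).const_mul β).exp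
  refine h.congr_fderiv ?_
  ext y
  simp [mul_assoc]

/-- The weights with exponent `0` are the softmax probabilities, the logarithmic derivative of
`expSum` up to `β`. Isolating the factor `r - 1` exposes the sign that drives Slepian's inequality.
-/
lemma hasFDerivAt_expSumWeight (β r : ℝ) (a : ι → E) (k : ι) (x : E) :
    HasFDerivAt (expSumWeight β r a k)
      (β • (expSumWeight β r a k x • innerSL ℝ (a k) + ((r - 1) * expSumWeight β r a k x) •
        ∑ j, expSumWeight β 0 a j x • innerSL ℝ (a j))) x := by
  have hS := expSum_pos β a x
  have h1 := (((innerSL ℝ (a k)).hasFDerivAt (x := x)).const_mul β).exp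
  have h2 := (hasFDerivAt_expSum β a x).rpow_const (p := r - 1) (Or.inl hS.ne')
  refine (h1.mul h2).congr_fderiv ?_
  ext y
  simp only [expSumWeight, innerSL_apply_apply, add_apply,
    smul_apply, smul_eq_mul, sum_apply, zero_sub]
  have h3 : expSum β a x ^ (r - 1 - 1) = expSum β a x ^ (r - 1) * expSum β a x ^ (-1 : ℝ) := by
    rw [← Real.rpow_add hS]; ring_nf
  rw [h3]
  simp only [Finset.mul_sum, mul_add]
  rw [add_comm]
  congr 1
  · ring
  · exact Finset.sum_congr rfl fun j _ => by ring

lemma abs_fderiv_expSumWeight_le {β r R : ℝ} (hβ : 0 ≤ β) (hr : r ∈ Set.Icc (0 : ℝ) 1)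
    {a : ι → E} (ha : ∀ k, ‖a k‖ ≤ R) (k : ι) (b x : E) :
    |fderiv ℝ (expSumWeight β r a k) x b| ≤
      β * (R * ‖b‖ * (1 + Fintype.card ι)) * expSum β a x ^ r := by
  rw [(hasFDerivAt_expSumWeight β r a k x).fderiv]
  simp only [add_apply, smul_apply, smul_eq_mul,
    sum_apply, innerSL_apply_apply]
  have hw := expSumWeight_le β r a k x
  have hw0 := expSumWeight_nonneg β r a k x
  have hab : ∀ j, |inner ℝ (a j) b| ≤ R * ‖b‖ := fun j => abs_inner_le_of_norm_le (ha j) b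
  have hRb : 0 ≤ R * ‖b‖ := (abs_nonneg _).trans (hab k)
  have hsum : |∑ j, expSumWeight β 0 a j x * inner ℝ (a j) b| ≤ R * ‖b‖ * Fintype.card ι := by
    refine (Finset.abs_sum_le_sum_abs _ _).trans ?_
    refine (Finset.sum_le_card_nsmul Finset.univ _ (R * ‖b‖) fun j _ => ?_).trans_eq
      (by simp [mul_comm])
    rw [abs_mul, abs_of_nonneg (expSumWeight_nonneg β 0 a j x)]
    refine (mul_le_mul ?_ (hab j) (abs_nonneg _) zero_le_one).trans_eq (one_mul _)
    simpa using expSumWeight_le β 0 a j x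
  rw [abs_mul, abs_of_nonneg hβ, mul_assoc β]
  refine mul_le_mul_of_nonneg_left ?_ hβ
  refine (abs_add_le _ _).trans ?_
  rw [abs_mul, abs_mul, abs_mul, abs_of_nonneg hw0]
  have hr1 : |r - 1| ≤ 1 := by rw [abs_le]; constructor <;> linarith [hr.1, hr.2]
  have h1 : expSumWeight β r a k x * |inner ℝ (a k) b| ≤ expSum β a x ^ r * (R * ‖b‖) :=
    mul_le_mul hw (hab k) (abs_nonneg _) (hw0.trans hw)
  have h2 : |r - 1| * expSumWeight β r a k x * |∑ j, expSumWeight β 0 a j x * inner ℝ (a j) b|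
      ≤ 1 * expSum β a x ^ r * (R * ‖b‖ * Fintype.card ι) := by
    refine mul_le_mul (mul_le_mul hr1 hw hw0 zero_le_one) hsum (abs_nonneg _) ?_
    exact mul_nonneg zero_le_one (hw0.trans hw)
  calc _ ≤ _ := add_le_add h1 h2
    _ = _ := by ring

/-- Stein's lemma trades each factor `⟪b k, x⟫` for a derivative along `b k`. Its diagonal part
vanishes by `hkk`; the rest is a product of `r - 1 ≤ 0` and a softmax average of the nonpositive `⟪a
j, b k⟫`. -/
lemma integral_sum_inner_mul_expSumWeight_nonneg {β r : ℝ} (hβ : 0 ≤ β)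
    (hr : r ∈ Set.Icc (0 : ℝ) 1) {a b : ι → E} (hkk : ∀ k, inner ℝ (a k) (b k) = 0)
    (hjk : ∀ j k, inner ℝ (a j) (b k) ≤ 0) :
    0 ≤ ∫ x, ∑ k, inner ℝ (b k) x * expSumWeight β r a k x ∂stdGaussian E := by
  set R := ∑ k, ‖a k‖
  have ha : ∀ k, ‖a k‖ ≤ R := fun k =>
    Finset.single_le_sum (f := fun k => ‖a k‖) (fun _ _ => norm_nonneg _) (Finset.mem_univ k)
  have hcont : Continuous fun x => expSum β a x ^ r :=
    (continuous_expSum β a).rpow_const fun x => Or.inl (expSum_pos β a x).ne'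
  have hSi := integrable_expSum_rpow hβ hr.1 a
  have hSb : ∀ x, expSum β a x ^ r ≤ (Fintype.card ι : ℝ) ^ r * Real.exp (r * β * (R * ‖x‖)) :=
    fun x => expSum_rpow_le hβ hr.1 a fun k => inner_le_of_norm_le (ha k) x
  have hwi : ∀ k, Integrable (expSumWeight β r a k) (stdGaussian E) := fun k =>
    hSi.mono' (continuous_expSumWeight β r a k).aestronglyMeasurable
      (Filter.Eventually.of_forall fun x => by
        rw [Real.norm_of_nonneg (expSumWeight_nonneg _ _ _ _ _)]
        exact expSumWeight_le β r a k x)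
  have hiw : ∀ k, Integrable (fun x => inner ℝ (b k) x * expSumWeight β r a k x)
      (stdGaussian E) := by
    intro k
    refine integrable_stdGaussian_of_le_exp
      ((by fun_prop : Continuous fun x => inner ℝ (b k) x).mul (continuous_expSumWeight β r a k))
      (‖b k‖ * (Fintype.card ι : ℝ) ^ r) (1 + r * β * R) fun x => ?_
    rw [abs_mul, abs_of_nonneg (expSumWeight_nonneg β r a k x)]
    have h1 : ‖x‖ ≤ Real.exp ‖x‖ := by linarith [Real.add_one_le_exp ‖x‖]
    calc |inner ℝ (b k) x| * expSumWeight β r a k x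
        ≤ (‖b k‖ * Real.exp ‖x‖) *
          ((Fintype.card ι : ℝ) ^ r * Real.exp (r * β * (R * ‖x‖))) := by
          refine mul_le_mul ?_ ((expSumWeight_le β r a k x).trans (hSb x))
            (expSumWeight_nonneg β r a k x) (by positivity)
          exact (abs_real_inner_le_norm _ _).trans
            (mul_le_mul_of_nonneg_left h1 (norm_nonneg _))
      _ = _ := by
          rw [mul_mul_mul_comm, ← Real.exp_add]
          ring_nf
  have hcd : ∀ k, Continuous fun x => fderiv ℝ (expSumWeight β r a k) x (b k) := by
    intro k
    simp_rw [fun x => (hasFDerivAt_expSumWeight β r a k x).fderiv]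
    simp only [add_apply, smul_apply, smul_eq_mul,
      sum_apply, innerSL_apply_apply]
    have := continuous_expSumWeight β r a
    have := continuous_expSumWeight β 0 a
    fun_prop
  rw [integral_finsetSum _ fun k _ => hiw k]
  refine Finset.sum_nonneg fun k _ => ?_
  rw [integral_inner_mul_stdGaussian
    (fun x => (hasFDerivAt_expSumWeight β r a k x).differentiableAt) (b k) (hwi k) ?_ (hiw k)]
  · refine integral_nonneg fun x => ?_
    rw [(hasFDerivAt_expSumWeight β r a k x).fderiv]
    simp only [add_apply, smul_apply, smul_eq_mul,
      sum_apply, innerSL_apply_apply, hkk, mul_zero, zero_add]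
    refine mul_nonneg hβ (mul_nonneg_of_nonpos_of_nonpos ?_ ?_)
    · exact mul_nonpos_of_nonpos_of_nonneg (by linarith [hr.2]) (expSumWeight_nonneg _ _ _ _ _)
    · exact Finset.sum_nonpos fun j _ =>
        mul_nonpos_of_nonneg_of_nonpos (expSumWeight_nonneg _ _ _ _ _) (hjk j k)
  · exact (hSi.const_mul _).mono' (hcd k).aestronglyMeasurable
      (Filter.Eventually.of_forall fun x => abs_fderiv_expSumWeight_le hβ hr ha k (b k) x)

/-- The derivative of `θ ↦ 𝔼 (∑ exp (β ⟪a k θ, x⟫)) ^ r` along the interpolation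
`a k θ = cos θ • p k + sin θ • q k`. -/
lemma hasDerivAt_integral_expSum_rpow {β r : ℝ} (hβ : 0 ≤ β) (hr : 0 ≤ r) (p q : ι → E) (θ : ℝ) :
    HasDerivAt (fun θ => ∫ x, expSum β (fun k => Real.cos θ • p k + Real.sin θ • q k) x ^ r
        ∂stdGaussian E)
      (∫ x, r * β * ∑ k, inner ℝ (-Real.sin θ • p k + Real.cos θ • q k) x *
        expSumWeight β r (fun k => Real.cos θ • p k + Real.sin θ • q k) k x ∂stdGaussian E) θ := by
  set R := ∑ k, (‖p k‖ + ‖q k‖) with hR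
  have hle : ∀ k, ‖p k‖ + ‖q k‖ ≤ R := fun k =>
    Finset.single_le_sum (f := fun k => ‖p k‖ + ‖q k‖) (fun _ _ => by positivity)
      (Finset.mem_univ k)
  have hnorm : ∀ (k : ι) (s c : ℝ), |s| ≤ 1 → |c| ≤ 1 → ‖s • p k + c • q k‖ ≤ R := by
    intro k s c hs hc
    refine (norm_add_le _ _).trans ((add_le_add ?_ ?_).trans (hle k))
    · rw [norm_smul]; exact mul_le_of_le_one_left (norm_nonneg _) hs
    · rw [norm_smul]; exact mul_le_of_le_one_left (norm_nonneg _) hc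
  have hR0 : 0 ≤ R := Finset.sum_nonneg fun k _ => by positivity
  have hcd : Continuous fun x => r * β * ∑ k, inner ℝ (-Real.sin θ • p k + Real.cos θ • q k) x *
        expSumWeight β r (fun k => Real.cos θ • p k + Real.sin θ • q k) k x := by
    have := continuous_expSumWeight β r (fun k => Real.cos θ • p k + Real.sin θ • q k)
    fun_prop
  refine (hasDerivAt_integral_of_dominated_loc_of_deriv_le
    (F := fun θ x => expSum β (fun k => Real.cos θ • p k + Real.sin θ • q k) x ^ r)
    (F' := fun θ x => r * β * ∑ k, inner ℝ (-Real.sin θ • p k + Real.cos θ • q k) x *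
        expSumWeight β r (fun k => Real.cos θ • p k + Real.sin θ • q k) k x)
    (bound := fun x => (r * β * (Fintype.card ι * (R * (Fintype.card ι : ℝ) ^ r))) *
      Real.exp ((1 + r * β * R) * ‖x‖))
    (s := Set.univ) Filter.univ_mem ?_ (integrable_expSum_rpow hβ hr _)
    hcd.aestronglyMeasurable ?_ ?_ ?_).2
  · exact Filter.Eventually.of_forall fun θ => (integrable_expSum_rpow hβ hr _).1
  · refine Filter.Eventually.of_forall fun x θ _ => ?_
    rw [Real.norm_eq_abs, abs_mul, abs_of_nonneg (mul_nonneg hr hβ), mul_assoc (r * β)]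
    refine mul_le_mul_of_nonneg_left ?_ (mul_nonneg hr hβ)
    refine (Finset.abs_sum_le_sum_abs _ _).trans ?_
    refine (Finset.sum_le_card_nsmul Finset.univ _
      (R * (Fintype.card ι : ℝ) ^ r * Real.exp ((1 + r * β * R) * ‖x‖)) fun k _ => ?_).trans_eq
      (by simp; ring)
    rw [abs_mul, abs_of_nonneg (expSumWeight_nonneg _ _ _ _ _)]
    have h1 : ‖x‖ ≤ Real.exp ‖x‖ := by linarith [Real.add_one_le_exp ‖x‖]
    have h2 : ‖-Real.sin θ • p k + Real.cos θ • q k‖ ≤ R :=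
      hnorm k _ _ (by rw [abs_neg]; exact Real.abs_sin_le_one θ) (Real.abs_cos_le_one θ)
    have h3 : expSum β (fun k => Real.cos θ • p k + Real.sin θ • q k) x ^ r ≤
        (Fintype.card ι : ℝ) ^ r * Real.exp (r * β * (R * ‖x‖)) :=
      expSum_rpow_le hβ hr _ fun k => inner_le_of_norm_le
        (hnorm k _ _ (Real.abs_cos_le_one θ) (Real.abs_sin_le_one θ)) x
    calc _ ≤ (R * Real.exp ‖x‖) * ((Fintype.card ι : ℝ) ^ r * Real.exp (r * β * (R * ‖x‖))) := by
          refine mul_le_mul ((abs_inner_le_of_norm_le h2 x).trans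
            (mul_le_mul_of_nonneg_left h1 hR0)) ((expSumWeight_le _ _ _ _ _).trans h3)
            (expSumWeight_nonneg _ _ _ _ _) (by positivity)
      _ = _ := by
          rw [mul_mul_mul_comm, ← Real.exp_add]
          ring_nf
  · exact (integrable_exp_mul_norm_stdGaussian _).const_mul _
  · refine Filter.Eventually.of_forall fun x θ _ => ?_
    have hS : HasDerivAt (fun θ => expSum β (fun k => Real.cos θ • p k + Real.sin θ • q k) x)
        (∑ k, Real.exp (β * inner ℝ (Real.cos θ • p k + Real.sin θ • q k) x) *
          (β * inner ℝ (-Real.sin θ • p k + Real.cos θ • q k) x)) θ := by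
      unfold expSum
      refine HasDerivAt.fun_sum fun k _ => HasDerivAt.exp (HasDerivAt.const_mul β ?_)
      simp only [inner_add_left, real_inner_smul_left]
      exact ((Real.hasDerivAt_cos θ).mul_const _).add ((Real.hasDerivAt_sin θ).mul_const _)
    refine (hS.rpow_const (p := r) (Or.inl (expSum_pos _ _ _).ne')).congr_deriv ?_
    simp only [expSumWeight, Finset.mul_sum, Finset.sum_mul]
    exact Finset.sum_congr rfl fun k _ => by ring

/-- **Slepian's inequality** for smoothed exponential moments. -/
theorem integral_expSum_rpow_le_of_orthogonal {β r : ℝ} (hβ : 0 ≤ β) (hr : r ∈ Set.Icc (0 : ℝ) 1)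
    {p q : ι → E} (hpq : ∀ j k, inner ℝ (p j) (q k) = 0) (hn : ∀ k, ‖p k‖ = ‖q k‖)
    (hc : ∀ j k, inner ℝ (q j) (q k) ≤ inner ℝ (p j) (p k)) :
    ∫ x, expSum β p x ^ r ∂stdGaussian E ≤ ∫ x, expSum β q x ^ r ∂stdGaussian E := by
  have hd := hasDerivAt_integral_expSum_rpow hβ hr.1 p q
  have hqp : ∀ j k, inner ℝ (q j) (p k) = 0 := fun j k => by rw [real_inner_comm, hpq]
  have hmono := monotoneOn_of_deriv_nonneg (convex_Icc 0 (Real.pi / 2))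
    (fun θ _ => (hd θ).continuousAt.continuousWithinAt)
    (fun θ _ => (hd θ).differentiableAt.differentiableWithinAt) (fun θ hθ => by
      rw [(hd θ).deriv, integral_const_mul]
      rw [interior_Icc] at hθ
      have hs := Real.sin_nonneg_of_nonneg_of_le_pi hθ.1.le (by linarith [hθ.2, Real.pi_pos])
      have hco := Real.cos_nonneg_of_neg_pi_div_two_le_of_le (by linarith [hθ.1, Real.pi_pos])
        hθ.2.le
      -- Orthogonality of the two families leaves only the difference of covariances; equal norms
      -- annihilate it on the diagonal.
      have hin : ∀ j k, inner ℝ (Real.cos θ • p j + Real.sin θ • q j)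
          (-Real.sin θ • p k + Real.cos θ • q k) =
          Real.sin θ * Real.cos θ * (inner ℝ (q j) (q k) - inner ℝ (p j) (p k)) := by
        intro j k
        simp only [inner_add_left, inner_add_right, real_inner_smul_left, real_inner_smul_right,
          hpq, hqp]
        ring
      refine mul_nonneg (mul_nonneg hr.1 hβ) (integral_sum_inner_mul_expSumWeight_nonneg hβ hr
        (fun k => ?_) fun j k => ?_)
      · rw [hin, real_inner_self_eq_norm_sq, real_inner_self_eq_norm_sq, hn, sub_self, mul_zero]
      · rw [hin]
        exact mul_nonpos_of_nonneg_of_nonpos (mul_nonneg hs hco) (by linarith [hc j k]))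
  have h := hmono (Set.left_mem_Icc.2 (by positivity)) (Set.right_mem_Icc.2 (by positivity))
    (by positivity : (0 : ℝ) ≤ Real.pi / 2)
  simpa using h

end Slepian

end ProbabilityTheory

/-! ### Chevet's inequality and the Davidson-Szarek tail bound. -/

namespace ProbabilityTheory

section Chevet

variable {X : Type*} [NormedAddCommGroup X] [InnerProductSpace ℝ X] [FiniteDimensional ℝ X]
  [MeasurableSpace X] [BorelSpace X]
  {Y : Type*} [NormedAddCommGroup Y] [InnerProductSpace ℝ Y] [FiniteDimensional ℝ Y]
  [MeasurableSpace Y] [BorelSpace Y]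
  {Z : Type*} [NormedAddCommGroup Z] [InnerProductSpace ℝ Z] [FiniteDimensional ℝ Z]
  [MeasurableSpace Z] [BorelSpace Z]

lemma stdGaussian_withLp_prod :
    stdGaussian (WithLp 2 (X × Y)) =
      ((stdGaussian X).prod (stdGaussian Y)).map (WithLp.toLp 2) := by
  have : IsProbabilityMeasure (((stdGaussian X).prod (stdGaussian Y)).map (WithLp.toLp 2)) :=
    Measure.isProbabilityMeasure_map (by fun_prop)
  refine Measure.ext_of_charFun (funext fun t => ?_)
  rw [charFun_prod, charFun_stdGaussian, charFun_stdGaussian, charFun_stdGaussian,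
    ← Complex.exp_add, ← Complex.ofReal_pow, WithLp.prod_norm_sq_eq_of_L2]
  congr 1
  push_cast
  simp only [WithLp.fst, WithLp.snd]
  ring

lemma inner_toLp_prod (x : X) (y : Y) (w : WithLp 2 (X × Y)) :
    inner ℝ (WithLp.toLp 2 (x, y)) w = inner ℝ x w.fst + inner ℝ y w.snd :=
  WithLp.prod_inner_apply _ _

lemma integral_stdGaussian_prod_mul (f : X → ℝ) (g : Y → ℝ) :
    ∫ x : WithLp 2 (X × Y), f x.fst * g x.snd ∂stdGaussian (WithLp 2 (X × Y)) =
      (∫ x, f x ∂stdGaussian X) * ∫ y, g y ∂stdGaussian Y := by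
  rw [stdGaussian_withLp_prod, ← MeasurableEquiv.coe_toLp, integral_map_equiv]
  exact integral_prod_mul f g

lemma integral_exp_mul_stdGaussian_real (l : ℝ) :
    ∫ t : ℝ, Real.exp (l * t) ∂stdGaussian ℝ = Real.exp (l ^ 2 / 2) := by
  have h : stdGaussian ℝ = gaussianReal 0 1 := by
    refine Measure.ext_of_charFun (funext fun t => ?_)
    rw [charFun_stdGaussian, charFun_gaussianReal, ← Complex.ofReal_pow, Real.norm_eq_abs, sq_abs]
    congr 1
    push_cast
    ring
  have h2 := mgf_gaussianReal (p := gaussianReal 0 1) (X := id) (μ := 0) (v := 1) (by simp) l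
  rw [h]
  simpa [mgf] using h2

/-- A Laplace transform version of **Chevet's inequality**. -/
theorem integral_expSum_rpow_le_of_inner_eq_mul {ι : Type*} [Fintype ι] [Nonempty ι]
    {P : ι → X} {z : ι → Y} {v : ι → Z}
    (hP : ∀ j k, inner ℝ (P j) (P k) = inner ℝ (z j) (z k) * inner ℝ (v j) (v k))
    (hz : ∀ k, ‖z k‖ = 1) (hv : ∀ k, ‖v k‖ = 1) {r l : ℝ} (hr : r ∈ Set.Ioc (0 : ℝ) 1)
    (hl : 0 < l) :
    ∫ x, expSum (l / r) P x ^ r ∂stdGaussian X ≤ (Fintype.card ι : ℝ) ^ r *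
      Real.exp (l * (√(Module.finrank ℝ Y) + √(Module.finrank ℝ Z)) + l ^ 2 / 2) := by
  have hβ : 0 ≤ l / r := div_nonneg hl.le hr.1.le
  have hrβ : r * (l / r) = l := mul_div_cancel₀ _ hr.1.ne'
  -- The extra coordinate `1` carries the independent scalar Gaussian that equalises variances: both
  -- families have squared norm `2`. Separate blocks make them orthogonal.
  let p : ι → WithLp 2 (WithLp 2 (X × ℝ) × WithLp 2 (Y × Z)) :=
    fun k => WithLp.toLp 2 (WithLp.toLp 2 (P k, 1), 0)
  let q : ι → WithLp 2 (WithLp 2 (X × ℝ) × WithLp 2 (Y × Z)) :=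
    fun k => WithLp.toLp 2 (0, WithLp.toLp 2 (z k, v k))
  have hpx : ∀ k x, inner ℝ (p k) x = inner ℝ (P k) x.fst.fst + x.fst.snd := by
    intro k x
    simp only [p, inner_toLp_prod, inner_zero_left, add_zero]
    simp
  have hqx : ∀ k x, inner ℝ (q k) x = inner ℝ (z k) x.snd.fst + inner ℝ (v k) x.snd.snd := by
    intro k x
    simp only [q, inner_toLp_prod, inner_zero_left, zero_add]
  have hzz : ∀ k, inner ℝ (z k) (z k) = (1 : ℝ) := fun k => by
    rw [real_inner_self_eq_norm_sq, hz, one_pow]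
  have hvv : ∀ k, inner ℝ (v k) (v k) = (1 : ℝ) := fun k => by
    rw [real_inner_self_eq_norm_sq, hv, one_pow]
  have hpp : ∀ j k, inner ℝ (p j) (p k) = inner ℝ (z j) (z k) * inner ℝ (v j) (v k) + 1 := by
    intro j k
    rw [hpx]
    simp [p, hP]
  have hqq : ∀ j k, inner ℝ (q j) (q k) = inner ℝ (z j) (z k) + inner ℝ (v j) (v k) := by
    intro j k
    rw [hqx]
    rfl
  have hslep := integral_expSum_rpow_le_of_orthogonal hβ ⟨hr.1.le, hr.2⟩ (p := p) (q := q)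
    (fun j k => by rw [hpx]; simp [q])
    (fun k => by
      rw [← sq_eq_sq₀ (norm_nonneg _) (norm_nonneg _), ← real_inner_self_eq_norm_sq,
        ← real_inner_self_eq_norm_sq, hpp, hqq, hzz, hvv]; norm_num)
    (fun j k => by
      rw [hpp, hqq]
      have h1 : inner ℝ (z j) (z k) ≤ 1 := by
        simpa [hz] using real_inner_le_norm (z j) (z k)
      have h2 : inner ℝ (v j) (v k) ≤ 1 := by
        simpa [hv] using real_inner_le_norm (v j) (v k)
      -- The difference of covariances is `(1 - ⟪z j, z k⟫) (1 - ⟪v j, v k⟫) ≥ 0`.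
      nlinarith)
  have hleft : ∫ x, expSum (l / r) p x ^ r ∂stdGaussian _ =
      (∫ x, expSum (l / r) P x ^ r ∂stdGaussian X) * Real.exp (l ^ 2 / 2) := by
    have h1 : ∀ x, expSum (l / r) p x ^ r =
        (expSum (l / r) P x.fst.fst ^ r * Real.exp (l * x.fst.snd)) * 1 := by
      intro x
      have h2 : expSum (l / r) p x =
          expSum (l / r) P x.fst.fst * Real.exp (l / r * x.fst.snd) := by
        simp only [expSum, Finset.sum_mul, ← Real.exp_add]
        refine Finset.sum_congr rfl fun k _ => ?_
        congr 1
        rw [hpx, mul_add]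
      rw [h2, Real.mul_rpow (expSum_nonneg _ _ _) (Real.exp_pos _).le, ← Real.exp_mul, mul_one]
      congr 2
      rw [mul_comm (l / r * _), ← mul_assoc, hrβ]
    simp_rw [h1]
    rw [integral_stdGaussian_prod_mul
      (f := fun y : WithLp 2 (X × ℝ) => expSum (l / r) P y.fst ^ r * Real.exp (l * y.snd))
      (g := fun _ => 1), integral_stdGaussian_prod_mul
      (f := fun y => expSum (l / r) P y ^ r) (g := fun t => Real.exp (l * t)),
      integral_exp_mul_stdGaussian_real]
    simp
  have hright : ∫ x, expSum (l / r) q x ^ r ∂stdGaussian _ ≤ (Fintype.card ι : ℝ) ^ r *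
      (Real.exp (l * √(Module.finrank ℝ Y) + l ^ 2 / 2) *
        Real.exp (l * √(Module.finrank ℝ Z) + l ^ 2 / 2)) := by
    have h1 : ∀ x, expSum (l / r) q x ^ r ≤ (Fintype.card ι : ℝ) ^ r *
        (1 * (Real.exp (l * ‖x.snd.fst‖) * Real.exp (l * ‖x.snd.snd‖))) := by
      intro x
      have h2 : ∀ k, inner ℝ (q k) x ≤ ‖x.snd.fst‖ + ‖x.snd.snd‖ := by
        intro k
        have h3 := real_inner_le_norm (z k) x.snd.fst
        have h4 := real_inner_le_norm (v k) x.snd.snd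
        rw [hz, one_mul] at h3
        rw [hv, one_mul] at h4
        rw [hqx]
        exact add_le_add h3 h4
      refine (expSum_rpow_le hβ hr.1.le q h2).trans_eq ?_
      rw [hrβ, one_mul, ← Real.exp_add, mul_add]
    refine (integral_mono_of_nonneg (Filter.Eventually.of_forall fun x =>
      Real.rpow_nonneg (expSum_nonneg _ _ _) _) ?_ (Filter.Eventually.of_forall h1)).trans ?_
    · refine Integrable.const_mul ?_ _
      refine integrable_stdGaussian_of_le_exp (by fun_prop) 1 (l * 2) fun x => ?_
      rw [one_mul, one_mul, ← Real.exp_add, abs_of_pos (Real.exp_pos _), Real.exp_le_exp,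
        mul_assoc, ← mul_add]
      refine mul_le_mul_of_nonneg_left ?_ hl.le
      have h2 := WithLp.norm_snd_le (x := x)
      have h3 := WithLp.norm_fst_le (x := x.snd)
      have h4 := WithLp.norm_snd_le (x := x.snd)
      linarith
    · rw [integral_const_mul, integral_stdGaussian_prod_mul (f := fun _ => 1)
        (g := fun y : WithLp 2 (Y × Z) => Real.exp (l * ‖y.fst‖) * Real.exp (l * ‖y.snd‖)),
        integral_stdGaussian_prod_mul (f := fun y => Real.exp (l * ‖y‖))
        (g := fun y => Real.exp (l * ‖y‖))]
      refine mul_le_mul_of_nonneg_left ?_ (by positivity)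
      simp only [integral_const, probReal_univ, smul_eq_mul, mul_one, one_mul]
      exact mul_le_mul (integral_exp_mul_norm_stdGaussian_le hl)
        (integral_exp_mul_norm_stdGaussian_le hl) (integral_nonneg fun _ => (Real.exp_pos _).le)
        (Real.exp_pos _).le
  rw [hleft] at hslep
  have h := hslep.trans hright
  rw [← le_div_iff₀ (Real.exp_pos _), mul_div_assoc, ← Real.exp_add, ← Real.exp_sub] at h
  refine h.trans_eq ?_
  congr 2
  ring

lemma stdGaussian_real_exists_inner_gt_le {ι : Type*} [Fintype ι]
    {P : ι → X} {z : ι → Y} {v : ι → Z}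
    (hP : ∀ j k, inner ℝ (P j) (P k) = inner ℝ (z j) (z k) * inner ℝ (v j) (v k))
    (hz : ∀ k, ‖z k‖ = 1) (hv : ∀ k, ‖v k‖ = 1) {s : ℝ} (hs : 0 < s) :
    (stdGaussian X).real
      {x | ∃ k, √(Module.finrank ℝ Y) + √(Module.finrank ℝ Z) + s < inner ℝ (P k) x} ≤
      Real.exp (-s ^ 2 / 2) := by
  rcases isEmpty_or_nonempty ι with hι | hι
  · simp [(Real.exp_pos _).le]
  set D := √(Module.finrank ℝ Y) + √(Module.finrank ℝ Z) with hD
  set A := {x | ∃ k, D + s < inner ℝ (P k) x} with hA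
  have hAm : MeasurableSet A := by
    rw [hA, Set.ofPred_exists]
    exact MeasurableSet.iUnion fun k => measurableSet_lt (by fun_prop) (by fun_prop)
  have key : ∀ r ∈ Set.Ioc (0 : ℝ) 1, (stdGaussian X).real A ≤
      (Fintype.card ι : ℝ) ^ r * Real.exp (-s ^ 2 / 2) := by
    intro r hr
    have hβ : 0 ≤ s / r := div_nonneg hs.le hr.1.le
    -- Markov's inequality at `l = s`, which minimises `l D + l²/2 - l (D + s)`.
    have h1 := integral_expSum_rpow_le_of_inner_eq_mul hP hz hv hr hs
    have h2 : Real.exp (s * (D + s)) * (stdGaussian X).real A ≤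
        ∫ x, expSum (s / r) P x ^ r ∂stdGaussian X := by
      rw [mul_comm, ← smul_eq_mul, ← integral_indicator_const _ hAm]
      refine integral_mono ((integrable_const _).indicator hAm)
        (integrable_expSum_rpow hβ hr.1.le P) fun x => ?_
      by_cases hx : x ∈ A
      · obtain ⟨k, hk⟩ := hx
        simp only [Set.indicator_of_mem (show x ∈ A from ⟨k, hk⟩)]
        calc Real.exp (s * (D + s)) = Real.exp (s / r * (D + s)) ^ r := by
              rw [← Real.exp_mul]
              congr 1
              have := hr.1.ne'
              field_simp
          _ ≤ _ := by
              refine Real.rpow_le_rpow (Real.exp_pos _).le (le_trans ?_ (exp_le_expSum _ P x k))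
                hr.1.le
              exact Real.exp_le_exp.2 (mul_le_mul_of_nonneg_left hk.le hβ)
      · simp only [Set.indicator_of_notMem hx]
        exact Real.rpow_nonneg (expSum_nonneg _ _ _) _
    have h3 := h2.trans h1
    rw [mul_comm, ← le_div_iff₀ (Real.exp_pos _), mul_div_assoc, ← Real.exp_sub] at h3
    refine h3.trans_eq ?_
    congr 2
    ring
  -- Letting `r → 0` removes the cardinality, so the bound survives passage to infinite index sets.
  have hlim : Filter.Tendsto (fun r : ℝ => (Fintype.card ι : ℝ) ^ r * Real.exp (-s ^ 2 / 2))
      (nhdsWithin 0 (Set.Ioi 0)) (nhds (Real.exp (-s ^ 2 / 2))) := by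
    have hc : Continuous fun r : ℝ => (Fintype.card ι : ℝ) ^ r * Real.exp (-s ^ 2 / 2) :=
      (Real.continuous_const_rpow (by exact_mod_cast Fintype.card_ne_zero)).mul continuous_const
    have := (hc.tendsto 0).mono_left (nhdsWithin_le_nhds (s := Set.Ioi 0))
    simpa using this
  refine ge_of_tendsto hlim ?_
  filter_upwards [Ioc_mem_nhdsGT (zero_lt_one' ℝ)] with r hr using key r hr

/-- The Davidson-Szarek tail bound for the operator norm of a Gaussian matrix, with the matrix seen
as an element `x` of a Hilbert space `X` and its bilinear form given by `z, v ↦ ⟪Φ z v, x⟫`. -/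
theorem stdGaussian_real_exists_inner_bilin_gt_le (Φ : Y →ₗ[ℝ] Z →ₗ[ℝ] X)
    (hΦ : ∀ z z' v v', inner ℝ (Φ z v) (Φ z' v') = inner ℝ z z' * inner ℝ v v')
    {s : ℝ} (hs : 0 < s) :
    (stdGaussian X).real {x | ∃ z v,
      (√(Module.finrank ℝ Y) + √(Module.finrank ℝ Z) + s) * (‖z‖ * ‖v‖) < inner ℝ (Φ z v) x} ≤
      Real.exp (-s ^ 2 / 2) := by
  set c := √(Module.finrank ℝ Y) + √(Module.finrank ℝ Z) + s with hc
  -- The violation is an open condition on `(z, v)`, so it already occurs at a pair from countable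
  -- dense sequences. Such a pair has nonzero entries and can be normalised. Finite subfamilies then
  -- increase to the whole event.
  let ι := {n : ℕ × ℕ // TopologicalSpace.denseSeq Y n.1 ≠ 0 ∧ TopologicalSpace.denseSeq Z n.2 ≠ 0}
  let z : ι → Y := fun k => ‖TopologicalSpace.denseSeq Y k.1.1‖⁻¹ • TopologicalSpace.denseSeq Y k.1.1
  let v : ι → Z := fun k => ‖TopologicalSpace.denseSeq Z k.1.2‖⁻¹ • TopologicalSpace.denseSeq Z k.1.2
  have hz : ∀ k, ‖z k‖ = 1 := fun k => norm_smul_inv_norm (𝕜 := ℝ) k.2.1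
  have hv : ∀ k, ‖v k‖ = 1 := fun k => norm_smul_inv_norm (𝕜 := ℝ) k.2.2
  have hsub : {x | ∃ z v, c * (‖z‖ * ‖v‖) < inner ℝ (Φ z v) x} ⊆
      ⋃ F : Finset ι, {x | ∃ k : F, c < inner ℝ (Φ (z k) (v k)) x} := by
    rintro x ⟨z₀, v₀, h⟩
    have hcont : Continuous fun y : Y × Z => inner ℝ (Φ y.1 y.2) x := by
      let Ψ : Y →ₗ[ℝ] Z →ₗ[ℝ] ℝ := Φ.compr₂ ((innerSL ℝ x).toLinearMap)
      have h2 : Continuous fun y : Y × Z => Ψ.toContinuousBilinearMap y.1 y.2 := by fun_prop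
      refine h2.congr fun y => ?_
      simp [Ψ, real_inner_comm]
    have hopen : IsOpen {y : Y × Z | c * (‖y.1‖ * ‖y.2‖) < inner ℝ (Φ y.1 y.2) x} :=
      isOpen_lt (by fun_prop) hcont
    obtain ⟨n, hn⟩ := ((TopologicalSpace.denseRange_denseSeq Y).prodMap
      (TopologicalSpace.denseRange_denseSeq Z)).exists_mem_open hopen ⟨(z₀, v₀), h⟩
    simp only [Set.mem_ofPred_eq, Prod.map_fst, Prod.map_snd] at hn
    have hy : TopologicalSpace.denseSeq Y n.1 ≠ 0 := fun h0 => by simp [h0] at hn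
    have hz' : TopologicalSpace.denseSeq Z n.2 ≠ 0 := fun h0 => by simp [h0] at hn
    refine Set.mem_iUnion.2 ⟨{⟨n, hy, hz'⟩}, ⟨⟨⟨n, hy, hz'⟩, Finset.mem_singleton_self _⟩, ?_⟩⟩
    have hy0 := norm_pos_iff.2 hy
    have hz0 := norm_pos_iff.2 hz'
    simp only [z, v, map_smul, LinearMap.smul_apply, real_inner_smul_left]
    rw [← mul_assoc, ← mul_inv, inv_mul_eq_div, lt_div_iff₀ (by positivity)]
    linarith
  have hdir : Directed (· ⊆ ·) fun F : Finset ι => {x | ∃ k : F, c < inner ℝ (Φ (z k) (v k)) x} := by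
    classical
    refine fun F G => ⟨F ∪ G, ?_, ?_⟩
    · rintro x ⟨k, hk⟩
      exact ⟨⟨k, Finset.mem_union_left _ k.2⟩, hk⟩
    · rintro x ⟨k, hk⟩
      exact ⟨⟨k, Finset.mem_union_right _ k.2⟩, hk⟩
  refine ENNReal.toReal_le_of_le_ofReal (Real.exp_pos _).le ((measure_mono hsub).trans ?_)
  rw [hdir.measure_iUnion]
  refine iSup_le fun F => ?_
  rw [← ENNReal.ofReal_toReal (measure_ne_top (stdGaussian X) _)]
  exact ENNReal.ofReal_le_ofReal (stdGaussian_real_exists_inner_gt_le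
    (fun j k => hΦ _ _ _ _) (fun k : F => hz k) (fun k : F => hv k) hs)

end Chevet

end ProbabilityTheory

/-! ### Deterministic least-squares error bound. -/

namespace BilinearId

/-- Finiteness forbids any component of `a` along a zero eigenvalue, so `a` lies in the range of `M`
and dividing its eigencoordinates by the eigenvalues gives a preimage; `0⁻¹ = 0` in `ℝ` covers the
kernel. -/
lemma exists_mulVec_eq_of_invQuadForm_ne_top {n : Type} [Fintype n] [DecidableEq n]
    {M : Matrix n n ℝ} (hM : M.PosSemidef) {a : n → ℝ}
    (ha : invQuadForm hM.isHermitian a ≠ ∞) :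
    ∃ u, M *ᵥ u = a ∧ invQuadForm hM.isHermitian a = ENNReal.ofReal (u ⬝ᵥ (M *ᵥ u)) := by
  set b := hM.isHermitian.eigenvectorBasis with hb
  set l := hM.isHermitian.eigenvalues with hl
  have hl0 : ∀ j, 0 ≤ l j := hM.eigenvalues_nonneg
  have hterm : ∀ j, l j = 0 → (b j).ofLp ⬝ᵥ a = 0 := by
    intro j hj
    by_contra hne
    refine ha (ENNReal.sum_eq_top.2 ⟨j, Finset.mem_univ j, ?_⟩)
    rw [← hl, hj, ENNReal.ofReal_zero, ENNReal.inv_zero, ENNReal.top_mul]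
    rw [ne_eq, ENNReal.ofReal_eq_zero, not_le]
    exact sq_pos_of_ne_zero hne
  have hsum : a = ∑ j, ((b j).ofLp ⬝ᵥ a) • (b j).ofLp := by
    have := congrArg WithLp.ofLp (b.sum_repr' (WithLp.toLp 2 a))
    simp only [WithLp.ofLp_sum, WithLp.ofLp_smul,
      EuclideanSpace.inner_eq_star_dotProduct, star_trivial] at this
    conv_lhs => rw [← this]
    exact Finset.sum_congr rfl fun j _ => by rw [dotProduct_comm]
  have hu : M *ᵥ (∑ j, ((l j)⁻¹ * ((b j).ofLp ⬝ᵥ a)) • (b j).ofLp) = a := by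
    rw [Matrix.mulVec_sum]
    conv_rhs => rw [hsum]
    refine Finset.sum_congr rfl fun j _ => ?_
    rw [Matrix.mulVec_smul, hM.isHermitian.mulVec_eigenvectorBasis j, smul_smul]
    congr 1
    by_cases hj : l j = 0
    · rw [hterm j hj]; simp
    · rw [← hl]; field_simp
  refine ⟨_, hu, ?_⟩
  rw [hu, sum_dotProduct, invQuadForm, ENNReal.ofReal_sum_of_nonneg]
  · refine Finset.sum_congr rfl fun j _ => ?_
    rw [smul_dotProduct, smul_eq_mul, mul_assoc, ← sq, ← hl, ← hb]
    rcases (hl0 j).eq_or_lt with hj | hj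
    · rw [hterm j hj.symm]; simp
    · rw [ENNReal.ofReal_mul (inv_nonneg.2 hj.le), ENNReal.ofReal_inv_of_pos hj]
  · intro j _
    rw [smul_dotProduct, smul_eq_mul, mul_assoc, ← sq]
    exact mul_nonneg (inv_nonneg.2 (hl0 j)) (sq_nonneg _)

/-- The normal equations of least squares. -/
lemma IsOLS.sum_mul_inner_residual_eq_zero {nx T : ℕ}
    {x xplus : Fin T → EuclideanSpace ℝ (Fin nx)} {θ : Matrix (Fin nx) (Fin nx ⊕ Unit) ℝ}
    (h : IsOLS x xplus θ) (u : Fin nx ⊕ Unit → ℝ) (v : EuclideanSpace ℝ (Fin nx)) :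
    ∑ t, (u ⬝ᵥ regressor (x t)) *
      inner ℝ (xplus t - WithLp.toLp 2 (θ *ᵥ regressor (x t))) v = 0 := by
  set r := fun t => xplus t - WithLp.toLp 2 (θ *ᵥ regressor (x t)) with hr
  set S := ∑ t, (u ⬝ᵥ regressor (x t)) * inner ℝ (r t) v with hS
  -- Perturb the minimiser by `ε v uᵀ`. The cost increment is a nonnegative quadratic in `ε` without
  -- constant term, so its discriminant `4 S²` is at most zero.
  have hq : ∀ ε : ℝ, 0 ≤ (∑ t, (u ⬝ᵥ regressor (x t)) ^ 2 * ‖v‖ ^ 2) * (ε * ε) +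
      (-2 * S) * ε + 0 := by
    intro ε
    have h1 := h (θ + ε • Matrix.vecMulVec v.ofLp u)
    have h2 : ∀ t, ‖xplus t - WithLp.toLp 2 ((θ + ε • Matrix.vecMulVec v.ofLp u) *ᵥ
        regressor (x t))‖ ^ 2 = ‖r t‖ ^ 2 - 2 * ε * ((u ⬝ᵥ regressor (x t)) * inner ℝ (r t) v) +
          (u ⬝ᵥ regressor (x t)) ^ 2 * ‖v‖ ^ 2 * (ε * ε) := by
      intro t
      have h3 : xplus t - WithLp.toLp 2 ((θ + ε • Matrix.vecMulVec v.ofLp u) *ᵥ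
          regressor (x t)) = r t - (ε * (u ⬝ᵥ regressor (x t))) • v := by
        rw [Matrix.add_mulVec, Matrix.smul_mulVec, Matrix.vecMulVec_mulVec, hr]
        ext i
        simp
        ring
      rw [h3, norm_sub_sq_real, real_inner_smul_right, norm_smul, mul_pow, Real.norm_eq_abs, sq_abs]
      ring
    unfold lsCost at h1
    simp_rw [h2] at h1
    rw [Finset.sum_add_distrib, Finset.sum_sub_distrib, ← Finset.mul_sum, ← Finset.sum_mul] at h1
    linarith
  have hd := discrim_le_zero hq
  rw [discrim] at hd
  have : S ^ 2 ≤ 0 := by nlinarith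
  exact pow_eq_zero_iff two_ne_zero |>.1 (le_antisymm this (sq_nonneg S))

/-- The regressor `(ξ, 1)` in the units of `ξ = x / σx`. -/
noncomputable def scaledRegressor {nx : ℕ} (σx : ℝ) (x : EuclideanSpace ℝ (Fin nx)) : Fin nx ⊕ Unit → ℝ :=
  Sum.elim (σx⁻¹ • x.ofLp) (fun _ => 1)

lemma dataMatrix_eq_sum {nx T : ℕ} (σx : ℝ) (x : Fin T → EuclideanSpace ℝ (Fin nx)) :
    dataMatrix σx x =
      ∑ t, Matrix.vecMulVec (scaledRegressor σx (x t)) (scaledRegressor σx (x t)) := by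
  ext i j
  rcases i with i | i <;> rcases j with j | j <;>
    simp [dataMatrix, scaledRegressor, Matrix.sum_apply, Matrix.vecMulVec_apply, mul_assoc,
      mul_left_comm]

lemma dataMatrix_mulVec {nx T : ℕ} (σx : ℝ) (x : Fin T → EuclideanSpace ℝ (Fin nx))
    (u : Fin nx ⊕ Unit → ℝ) : dataMatrix σx x *ᵥ u =
      ∑ t, (scaledRegressor σx (x t) ⬝ᵥ u) • scaledRegressor σx (x t) := by
  rw [dataMatrix_eq_sum, Matrix.sum_mulVec]
  refine Finset.sum_congr rfl fun t _ => ?_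
  rw [Matrix.vecMulVec_mulVec]
  simp

lemma dotProduct_dataMatrix_mulVec {nx T : ℕ} (σx : ℝ) (x : Fin T → EuclideanSpace ℝ (Fin nx))
    (u : Fin nx ⊕ Unit → ℝ) :
    u ⬝ᵥ (dataMatrix σx x *ᵥ u) = ∑ t, (scaledRegressor σx (x t) ⬝ᵥ u) ^ 2 := by
  rw [dataMatrix_mulVec, dotProduct_sum]
  refine Finset.sum_congr rfl fun t _ => ?_
  rw [dotProduct_smul, smul_eq_mul, dotProduct_comm u, sq]

lemma dataMatrix_posSemidef {nx T : ℕ} (σx : ℝ) (x : Fin T → EuclideanSpace ℝ (Fin nx)) :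
    (dataMatrix σx x).PosSemidef := by
  rw [Matrix.posSemidef_iff_dotProduct_mulVec]
  refine ⟨dataMatrix_isHermitian σx x, fun u => ?_⟩
  rw [star_trivial, dotProduct_dataMatrix_mulVec]
  exact Finset.sum_nonneg fun t _ => sq_nonneg _

lemma stackedError_apply {nx : ℕ} (σx : ℝ) (θhat θ : Matrix (Fin nx) (Fin nx ⊕ Unit) ℝ)
    (i : Fin nx ⊕ Unit) (j : Fin nx) : stackedError σx θhat θ i j =
      Sum.elim (fun _ => σx) (fun _ => 1) i * (θhat - θ) j i :=
  Matrix.diagonal_mul _ _ i j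

lemma stackedError_transpose_mulVec_scaledRegressor {nx : ℕ} {σx : ℝ} (hσx : σx ≠ 0)
    (θhat θ : Matrix (Fin nx) (Fin nx ⊕ Unit) ℝ) (x : EuclideanSpace ℝ (Fin nx)) :
    (stackedError σx θhat θ)ᵀ *ᵥ scaledRegressor σx x = (θhat - θ) *ᵥ regressor x := by
  ext j
  simp only [Matrix.mulVec, dotProduct]
  refine Finset.sum_congr rfl fun i _ => ?_
  rw [Matrix.transpose_apply, stackedError_apply]
  rcases i with i | i
  · simp only [scaledRegressor, regressor, Sum.elim_inl, Pi.smul_apply, smul_eq_mul]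
    field_simp
  · simp [scaledRegressor, regressor]

lemma affineStep_eq {nx : ℕ} (B : Matrix (Fin nx) (Fin nx) ℝ) (b : Fin nx → ℝ)
    (x w : EuclideanSpace ℝ (Fin nx)) :
    affineStep B b x w = WithLp.toLp 2 (param B b *ᵥ regressor x) + w := by
  rw [affineStep, param, regressor, Matrix.fromCols_mulVec]
  congr 2
  ext i
  simp [Matrix.mulVec, dotProduct, add_comm]

/-- If the noise is bounded by `κ` as a bilinear form on the column space of the regressors, then
every least-squares estimate satisfies the ellipsoidal error bound. -/
theorem loewnerLEInv_of_isOLS {nx T : ℕ} {σx κ : ℝ} (hσx : σx ≠ 0) (hκ : 0 ≤ κ)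
    {B : Matrix (Fin nx) (Fin nx) ℝ} {b : Fin nx → ℝ}
    {x w : Fin T → EuclideanSpace ℝ (Fin nx)}
    (hw : ∀ (u : Fin nx ⊕ Unit → ℝ) (v : EuclideanSpace ℝ (Fin nx)),
      ∑ t, (u ⬝ᵥ regressor (x t)) * inner ℝ (w t) v ≤
        κ * (√(∑ t, (u ⬝ᵥ regressor (x t)) ^ 2) * ‖v‖))
    {θhat : Matrix (Fin nx) (Fin nx ⊕ Unit) ℝ}
    (hθ : IsOLS x (fun t => affineStep B b (x t) (w t)) θhat) :
    LoewnerLEInv (stackedError σx θhat (param B b) * (stackedError σx θhat (param B b))ᵀ)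
      (κ ^ 2) (dataMatrix_isHermitian σx x) := by
  intro a ha
  obtain ⟨u, rfl, hQ⟩ := exists_mulVec_eq_of_invQuadForm_ne_top (dataMatrix_posSemidef σx x) ha
  rw [hQ, ← ENNReal.ofReal_mul (sq_nonneg κ)]
  refine ENNReal.ofReal_le_ofReal ?_
  set E := stackedError σx θhat (param B b) with hE
  set Q := u ⬝ᵥ (dataMatrix σx x *ᵥ u) with hQdef
  set e : EuclideanSpace ℝ (Fin nx) := WithLp.toLp 2 (Eᵀ *ᵥ (dataMatrix σx x *ᵥ u)) with he
  -- Moving the scale from the regressor to the coefficient vector lets the unscaled bound `hw`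
  -- apply.
  let u' : Fin nx ⊕ Unit → ℝ := Sum.elim (fun i => σx⁻¹ * u (Sum.inl i)) (fun i => u (Sum.inr i))
  have hu' : ∀ t, u' ⬝ᵥ regressor (x t) = scaledRegressor σx (x t) ⬝ᵥ u := by
    intro t
    simp only [dotProduct, Fintype.sum_sum_type, u', regressor, scaledRegressor, Sum.elim_inl,
      Sum.elim_inr, Pi.smul_apply, smul_eq_mul]
    congr 1
    · exact Finset.sum_congr rfl fun i _ => by ring
    · exact Finset.sum_congr rfl fun i _ => by ring
  have hQsum : ∑ t, (u' ⬝ᵥ regressor (x t)) ^ 2 = Q := by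
    simp_rw [hu', hQdef, dotProduct_dataMatrix_mulVec]
  have hQ0 : 0 ≤ Q := hQsum ▸ Finset.sum_nonneg fun t _ => sq_nonneg _
  have hlhs : (dataMatrix σx x *ᵥ u) ⬝ᵥ ((E * Eᵀ) *ᵥ (dataMatrix σx x *ᵥ u)) = ‖e‖ ^ 2 := by
    rw [← real_inner_self_eq_norm_sq, ← Matrix.mulVec_mulVec, Matrix.dotProduct_mulVec,
      ← Matrix.mulVec_transpose, EuclideanSpace.inner_eq_star_dotProduct, star_trivial]
  have hesum : e = ∑ t, (u' ⬝ᵥ regressor (x t)) •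
      WithLp.toLp 2 ((θhat - param B b) *ᵥ regressor (x t)) := by
    rw [he, dataMatrix_mulVec, Matrix.mulVec_sum]
    simp_rw [Matrix.mulVec_smul, hE, stackedError_transpose_mulVec_scaledRegressor hσx, hu']
    simp
  have hnormal := hθ.sum_mul_inner_residual_eq_zero u' e
  have hres : ∀ t, affineStep B b (x t) (w t) - WithLp.toLp 2 (θhat *ᵥ regressor (x t)) =
      w t - WithLp.toLp 2 ((θhat - param B b) *ᵥ regressor (x t)) := by
    intro t
    rw [affineStep_eq, Matrix.sub_mulVec, WithLp.toLp_sub]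
    abel
  simp_rw [hres, inner_sub_left, mul_sub, Finset.sum_sub_distrib] at hnormal
  have hee : ‖e‖ ^ 2 = ∑ t, (u' ⬝ᵥ regressor (x t)) * inner ℝ (w t) e := by
    rw [← real_inner_self_eq_norm_sq]
    conv_lhs => rw [hesum]
    rw [sum_inner]
    simp_rw [real_inner_smul_left]
    rw [← hesum]
    linarith
  have hbound := hw u' e
  rw [← hee, hQsum] at hbound
  rw [hlhs]
  have h1 : ‖e‖ ≤ κ * √Q := by
    rcases (norm_nonneg e).eq_or_lt with h0 | h0
    · rw [← h0]; positivity
    · refine le_of_mul_le_mul_right ?_ h0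
      linarith [sq ‖e‖]
  calc ‖e‖ ^ 2 ≤ (κ * √Q) ^ 2 := by gcongr
    _ = κ ^ 2 * Q := by rw [mul_pow, Real.sq_sqrt hQ0]

end BilinearId

/-! ### Reduction of the noise law to a standard Gaussian. -/

namespace ProbabilityTheory

/-- Representing the noise as a multiple of a standard vector treats the degenerate case `σ = 0`
uniformly. -/
lemma multivariateGaussian_zero_sq_smul_one {ι : Type*} [Fintype ι] [DecidableEq ι] (σ : ℝ) :
    multivariateGaussian 0 (σ ^ 2 • (1 : Matrix ι ι ℝ)) =
      (stdGaussian (EuclideanSpace ℝ ι)).map (σ • ·) := by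
  have : IsProbabilityMeasure ((stdGaussian (EuclideanSpace ℝ ι)).map (σ • ·)) :=
    Measure.isProbabilityMeasure_map (by fun_prop)
  refine Measure.ext_of_charFun (funext fun t => ?_)
  rw [charFun_multivariateGaussian (Matrix.PosSemidef.one.smul (sq_nonneg σ)), charFun_map_smul,
    charFun_stdGaussian, Matrix.smul_mulVec, Matrix.one_mulVec, dotProduct_smul, norm_smul]
  have h : t.ofLp ⬝ᵥ t.ofLp = ‖t‖ ^ 2 := by
    rw [EuclideanSpace.real_norm_sq_eq, dotProduct]
    exact Finset.sum_congr rfl fun i _ => (sq _).symm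
  rw [h, ← Complex.ofReal_pow, mul_pow, Real.norm_eq_abs, sq_abs]
  congr 1
  simp
  ring

lemma pi_stdGaussian {ι : Type*} [Fintype ι] (V : Type*) [NormedAddCommGroup V]
    [InnerProductSpace ℝ V] [FiniteDimensional ℝ V] [MeasurableSpace V] [BorelSpace V] :
    Measure.pi (fun _ : ι => stdGaussian V) =
      (stdGaussian (PiLp 2 fun _ : ι => V)).map WithLp.ofLp := by
  have : IsProbabilityMeasure ((stdGaussian (PiLp 2 fun _ : ι => V)).map WithLp.ofLp) :=
    Measure.isProbabilityMeasure_map (by fun_prop)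
  symm
  rw [← charFun_eq_pi_iff]
  intro t
  rw [Measure.map_map (by fun_prop) (by fun_prop)]
  have : (WithLp.toLp 2 : (ι → V) → PiLp 2 fun _ : ι => V) ∘ WithLp.ofLp = id := rfl
  rw [this, Measure.map_id, charFun_stdGaussian, ← Complex.ofReal_pow,
    PiLp.norm_sq_eq_of_L2]
  simp_rw [charFun_stdGaussian]
  rw [← Complex.exp_sum]
  congr 1
  rw [← Finset.sum_div, Finset.sum_neg_distrib]
  push_cast
  rfl

end ProbabilityTheory

/-! ### Noise on the column space of the regressors. -/

namespace BilinearId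

/-- The linear map `u ↦ (⟨u, yₜ⟩)ₜ` given by the regressors `yₜ = (xₜ, 1)`. -/
noncomputable def regressorMap {nx T : ℕ} (x : Fin T → EuclideanSpace ℝ (Fin nx)) :
    (Fin nx ⊕ Unit → ℝ) →ₗ[ℝ] EuclideanSpace ℝ (Fin T) where
  toFun u := WithLp.toLp 2 fun t => u ⬝ᵥ regressor (x t)
  map_add' u v := by ext t; simp [add_dotProduct]
  map_smul' c u := by ext t; simp [smul_dotProduct]

lemma norm_regressorMap {nx T : ℕ} (x : Fin T → EuclideanSpace ℝ (Fin nx))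
    (u : Fin nx ⊕ Unit → ℝ) :
    ‖regressorMap x u‖ = √(∑ t, (u ⬝ᵥ regressor (x t)) ^ 2) := by
  rw [EuclideanSpace.norm_eq]
  simp [regressorMap]

lemma finrank_range_regressorMap_le {nx T : ℕ} (x : Fin T → EuclideanSpace ℝ (Fin nx)) :
    Module.finrank ℝ (LinearMap.range (regressorMap x)) ≤ nx + 1 := by
  refine (LinearMap.finrank_range_le _).trans ?_
  simp

/-- The bilinear map sending `z` and `v` to the matrix `z vᵀ`, stored by rows. -/
noncomputable def rankOne (T : ℕ) (V : Type*) [NormedAddCommGroup V] [InnerProductSpace ℝ V] :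
    EuclideanSpace ℝ (Fin T) →ₗ[ℝ] V →ₗ[ℝ] PiLp 2 (fun _ : Fin T => V) :=
  LinearMap.mk₂ ℝ (fun z v => WithLp.toLp 2 fun t => z t • v)
    (fun _ _ _ => by ext1 t; simp [add_smul])
    (fun _ _ _ => by ext1 t; simp [mul_smul])
    (fun _ _ _ => by ext1 t; simp [smul_add])
    (fun _ _ _ => by ext1 t; exact smul_comm _ _ _)

lemma inner_rankOne {T : ℕ} {V : Type*} [NormedAddCommGroup V] [InnerProductSpace ℝ V]
    (z : EuclideanSpace ℝ (Fin T)) (v : V) (W : PiLp 2 fun _ : Fin T => V) :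
    inner ℝ (rankOne T V z v) W = ∑ t, z t * inner ℝ (W t) v := by
  rw [PiLp.inner_apply]
  exact Finset.sum_congr rfl fun t _ => by
    simp [rankOne, real_inner_smul_left, real_inner_comm]

lemma inner_rankOne_rankOne {T : ℕ} {V : Type*} [NormedAddCommGroup V] [InnerProductSpace ℝ V]
    (z z' : EuclideanSpace ℝ (Fin T)) (v v' : V) :
    inner ℝ (rankOne T V z v) (rankOne T V z' v') = inner ℝ z z' * inner ℝ v v' := by
  rw [inner_rankOne, PiLp.inner_apply, Finset.sum_mul]
  refine Finset.sum_congr rfl fun t _ => ?_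
  simp [rankOne, real_inner_smul_left, real_inner_comm v']
  ring

/-- The pairs of states and noises for which the noise is bounded by `κ` as a bilinear form on the
column space of the regressors. -/
def noiseBounded (nx T : ℕ) (κ : ℝ) :
    Set ((Fin T → EuclideanSpace ℝ (Fin nx)) × (Fin T → EuclideanSpace ℝ (Fin nx))) :=
  {y | ∀ (u : Fin nx ⊕ Unit → ℝ) (v : EuclideanSpace ℝ (Fin nx)),
    ∑ t, (u ⬝ᵥ regressor (y.1 t)) * inner ℝ (y.2 t) v ≤
      κ * (√(∑ t, (u ⬝ᵥ regressor (y.1 t)) ^ 2) * ‖v‖)}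

lemma measurableSet_noiseBounded (nx T : ℕ) (κ : ℝ) : MeasurableSet (noiseBounded nx T κ) := by
  refine IsClosed.measurableSet ?_
  simp only [noiseBounded, Set.ofPred_forall]
  refine isClosed_iInter fun u => isClosed_iInter fun v => ?_
  have h : ∀ t : Fin T, Continuous fun y : (Fin T → EuclideanSpace ℝ (Fin nx)) ×
      (Fin T → EuclideanSpace ℝ (Fin nx)) => u ⬝ᵥ regressor (y.1 t) := by
    intro t
    simp only [dotProduct, Fintype.sum_sum_type, regressor, Sum.elim_inl, Sum.elim_inr]
    fun_prop
  refine isClosed_le ?_ ?_ <;> fun_prop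

/-- For frozen states, only the rank-one forms `z vᵀ` with `z` in the column space matter. Using
this subspace instead of all of `ℝ^T` replaces `√T` by `√(nx+1)`; rank deficiency only lowers the
dimension. -/
lemma stdGaussian_real_not_noiseBounded_le {nx T : ℕ} (x : Fin T → EuclideanSpace ℝ (Fin nx))
    {σ s : ℝ} (hσ : 0 ≤ σ) (hs : 0 < s) :
    (stdGaussian (PiLp 2 fun _ : Fin T => EuclideanSpace ℝ (Fin nx))).real
      {W | (x, fun t => σ • W t) ∉ noiseBounded nx T (σ * (√((nx : ℝ) + 1) + √(nx : ℝ) + s))} ≤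
      Real.exp (-s ^ 2 / 2) := by
  let K := LinearMap.range (regressorMap x)
  let Φ := (rankOne T (EuclideanSpace ℝ (Fin nx))).comp K.subtype
  refine le_trans (measureReal_mono ?_ (measure_ne_top _ _))
    (stdGaussian_real_exists_inner_bilin_gt_le Φ
      (fun z z' v v' => inner_rankOne_rankOne (z : EuclideanSpace ℝ (Fin T)) z' v v') hs)
  intro W hW
  simp only [noiseBounded, Set.mem_ofPred_eq, not_forall, not_le] at hW ⊢
  obtain ⟨u, v, huv⟩ := hW
  refine ⟨⟨regressorMap x u, u, rfl⟩, v, ?_⟩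
  have h1 : inner ℝ (Φ ⟨regressorMap x u, u, rfl⟩ v) W =
      ∑ t, (u ⬝ᵥ regressor (x t)) * inner ℝ (W t) v :=
    inner_rankOne _ _ _
  rw [h1, Submodule.coe_norm, norm_regressorMap]
  simp_rw [real_inner_smul_left, mul_left_comm _ σ] at huv
  rw [← Finset.mul_sum, mul_assoc] at huv
  have h2 := lt_of_mul_lt_mul_left huv hσ
  refine lt_of_le_of_lt (mul_le_mul_of_nonneg_right ?_ (by positivity)) h2
  have h3 : √(Module.finrank ℝ K : ℝ) ≤ √((nx : ℝ) + 1) :=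
    Real.sqrt_le_sqrt (by exact_mod_cast finrank_range_regressorMap_le x)
  have h4 : Module.finrank ℝ (EuclideanSpace ℝ (Fin nx)) = nx := finrank_euclideanSpace_fin
  rw [h4]
  linarith

end BilinearId

theorem mainTheorem5 {nx nu : ℕ} {Ω : Type*} [MeasurableSpace Ω]
    (μ : Measure Ω) [IsProbabilityMeasure μ]
    (B₀ : Matrix (Fin nx) (Fin nu) ℝ) (B : Fin nu → Matrix (Fin nx) (Fin nx) ℝ) (i : Fin nu)
    (σw σx δ : ℝ) (hσw : 0 ≤ σw) (hσx : 0 < σx) (hδ : δ ∈ Set.Ioo (0 : ℝ) 1)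
    (T : ℕ) (hT : nx + 1 ≤ T)
    (x w : Fin T → Ω → EuclideanSpace ℝ (Fin nx))
    (hx_meas : ∀ t, Measurable (x t)) (hw_meas : ∀ t, Measurable (w t))
    (hx_indep : iIndepFun x μ) (hx_ident : ∀ s t, IdentDistrib (x s) (x t) μ μ)
    (hw_indep : iIndepFun w μ)
    (hw_law : ∀ t, HasLaw (w t) (multivariateGaussian 0 (σw ^ 2 • 1)) μ)
    (hxw_indep : IndepFun (fun ω t => x t ω) (fun ω t => w t ω) μ) :
    ∃ G : Set Ω, MeasurableSet G ∧ 1 - δ / (2 * nu) ≤ μ.real G ∧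
      ∀ ω ∈ G, ∀ θhat : Matrix (Fin nx) (Fin nx ⊕ Unit) ℝ,
        BilinearId.IsOLS (fun t => x t ω)
          (fun t => BilinearId.affineStep (B i) (B₀.col i) (x t ω) (w t ω)) θhat →
        BilinearId.LoewnerLEInv
          (BilinearId.stackedError σx θhat (BilinearId.param (B i) (B₀.col i)) *
            (BilinearId.stackedError σx θhat (BilinearId.param (B i) (B₀.col i)))ᵀ)
          (BilinearId.C₁ σw nx nu δ)
          (BilinearId.dataMatrix_isHermitian σx (fun t => x t ω)) := by
  set s := √(2 * Real.log (2 * (nu : ℝ) / δ)) with hs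
  set c := √((nx : ℝ) + 1) + √(nx : ℝ) + s with hc
  have hnu : (1 : ℝ) ≤ nu := by exact_mod_cast i.pos
  have hδ0 : 0 < δ := hδ.1
  have hratio : 1 < 2 * (nu : ℝ) / δ := by
    rw [lt_div_iff₀ hδ0]; linarith [hδ.2]
  have hlog : 0 < 2 * Real.log (2 * (nu : ℝ) / δ) := mul_pos two_pos (Real.log_pos hratio)
  have hspos : 0 < s := Real.sqrt_pos.2 hlog
  -- The logarithmic term in `C₁` is the `s` that makes the tail equal to the allowed failure
  -- probability.
  have hexp : Real.exp (-s ^ 2 / 2) = δ / (2 * nu) := by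
    rw [hs, Real.sq_sqrt hlog.le, show -(2 * Real.log (2 * (nu : ℝ) / δ)) / 2 =
      -Real.log (2 * (nu : ℝ) / δ) by ring, Real.exp_neg, Real.exp_log (by linarith), inv_div]
  set N := BilinearId.noiseBounded nx T (σw * c) with hN
  have hNm : MeasurableSet N := BilinearId.measurableSet_noiseBounded nx T _
  have hxm : Measurable fun ω t => x t ω := measurable_pi_lambda _ hx_meas
  have hwm : Measurable fun ω t => w t ω := measurable_pi_lambda _ hw_meas
  have hlaw : μ.map (fun ω t => w t ω) =
      (stdGaussian (PiLp 2 fun _ : Fin T => EuclideanSpace ℝ (Fin nx))).map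
        (fun W t => σw • W t) := by
    rw [(iIndepFun_iff_map_fun_eq_pi_map fun t => (hw_meas t).aemeasurable).1 hw_indep]
    simp_rw [(hw_law _).map_eq, multivariateGaussian_zero_sq_smul_one]
    rw [← Measure.pi_map_pi fun _ => by fun_prop, pi_stdGaussian, Measure.map_map
      (by fun_prop) (by fun_prop)]
    rfl
  -- A bound uniform over state trajectories `y`; integrating it against the law of the states keeps
  -- the same constant.
  have hsection : ∀ y, (μ.map fun ω t => w t ω) (Prod.mk y ⁻¹' Nᶜ) ≤
      ENNReal.ofReal (δ / (2 * nu)) := by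
    intro y
    rw [hlaw, Measure.map_apply (by fun_prop) (measurable_prodMk_left hNm.compl), ← hexp,
      ← ENNReal.ofReal_toReal (measure_ne_top (stdGaussian _) _)]
    exact ENNReal.ofReal_le_ofReal
      (BilinearId.stdGaussian_real_not_noiseBounded_le y hσw hspos)
  refine ⟨(fun ω => ((fun t => x t ω), fun t => w t ω)) ⁻¹' N, (hxm.prodMk hwm) hNm, ?_, ?_⟩
  · have hbad : μ ((fun ω => ((fun t => x t ω), fun t => w t ω)) ⁻¹' N)ᶜ ≤
        ENNReal.ofReal (δ / (2 * nu)) := by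
      have : IsProbabilityMeasure (μ.map fun ω t => x t ω) :=
        Measure.isProbabilityMeasure_map hxm.aemeasurable
      rw [← Set.preimage_compl, ← Measure.map_apply (hxm.prodMk hwm) hNm.compl,
        (indepFun_iff_map_prod_eq_prod_map_map hxm.aemeasurable hwm.aemeasurable).1 hxw_indep,
        Measure.prod_apply hNm.compl]
      refine (lintegral_mono hsection).trans ?_
      simp
    have h2 := ENNReal.toReal_le_of_le_ofReal (by positivity) hbad
    have h3 := probReal_compl_eq_one_sub (μ := μ) ((hxm.prodMk hwm) hNm)
    rw [measureReal_def] at h3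
    linarith
  · intro ω hω θhat hθ
    have hC : BilinearId.C₁ σw nx nu δ = (σw * c) ^ 2 := by
      rw [BilinearId.C₁, mul_pow]
    rw [hC]
    exact BilinearId.loewnerLEInv_of_isOLS hσx.ne' (by positivity) hω hθ
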